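/- Let $\Lambda$ be a countable small category, with range and source maps $r,s$; $\alpha\beta$ is defined when $s(\alpha)=r(\beta)$, objects are identified with identity morphisms, and $\alpha\Lambda:=\{\alpha\beta : \beta\in\Lambda,\ r(\beta)=s(\alpha)\}$. Write $\alpha\Cap\beta$ if $\alpha\Lambda\cap\beta\Lambda\neq\emptyset$. Assume that $\Lambda$ is left cancellative ($\alpha\beta=\alpha\gamma$ implies $\beta=\gamma$) and finitely aligned (for all $\alpha,\beta\in\Lambda$ there is a finite set $\Gamma\subseteq\Lambda$ with $\alpha\Lambda\cap\beta\Lambda=\bigcup_{\gamma\in\Gamma}\gamma\Lambda$). *The semigroup.* Let $\mathcal S_\Lambda$ be the semigroup of partial bijections of the set $\Lambda$ generated by the maps $\tau^\alpha:s(\alpha)\Lambda\to\alpha\Lambda$, $\beta\mapsto\alpha\beta$, and $\sigma^\alpha:=(\tau^\alpha)^{-1}$, $\alpha\in\Lambda$. It is an inverse semigroup with $s^*=s^{-1}$; let $\mathcal E$ be its set of idempotents, ordered by $e\le f$ iff $e=ef$, and let $0$ denote the empty map (whether or not it belongs to $\mathcal S_\Lambda$). For $s\in\mathcal S_\Lambda$,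 an idempotent $e\le s^*s$ is *fixed under $s$* if $se=e$, and *weakly fixed under $s$* if $(sfs^*)f\neq0$ for every non-zero idempotent $f\le e$. A *cover* for $e\in\mathcal E$ is a set $Z\subseteq\{f\in\mathcal E : f\le e\}$ such that for every non-zero $f\in\mathcal E$ with $f\le e$ there is $z\in Z$ with $zf\neq 0$. *Filters and the tight groupoid.* A *filter* is a non-empty subset $\eta\subseteq\mathcal E$ that does not contain $0$, is upward closed in $\mathcal E$ and is closed under products; an *ultrafilter* is a maximal filter. The sets $\{\eta : X\subseteq\eta,\ Y\cap\eta=\emptyset\}$, for finite $X,Y\subseteq\mathcal E$, form a basis of a topology on the set of filters. Let $\hat{\mathcal E}_\infty$ be the set of ultrafilters and let $\hat{\mathcal E}_{\mathrm{tight}}$, the space of *tight filters*, be its closure. The semigroup $\mathcal S_\Lambda$ acts on $\hat{\mathcal E}_{\mathrm{tight}}$: for $s^*s\in\eta$ put $s\cdot\eta=\{f\in\mathcal E : ses^*\le f\text{ for some }e\in\eta\}$. The tight groupoid $\mathcal G_{\mathrm{tight}}(\mathcal S_\Lambda)$ is the groupoid of germs $[s,\eta]$ with $s\in\mathcal S_\Lambda$,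 $\eta\in\hat{\mathcal E}_{\mathrm{tight}}$ and $s^*s\in\eta$, where $[s,\eta]=[t,\zeta]$ iff $\eta=\zeta$ and $se=te$ for some $e\in\mathcal E$ with $e\in\eta$. Its structure is $d([s,\eta])=\eta$, $r([s,\eta])=s\cdot\eta$, $[s,t\cdot\eta][t,\eta]=[st,\eta]$ and $[s,\eta]^{-1}=[s^*,s\cdot\eta]$, and a basis of its topology is given by the sets $\{[s,\eta] : \eta\in U\}$ with $s\in\mathcal S_\Lambda$ and $U\subseteq\{\eta\in\hat{\mathcal E}_{\mathrm{tight}} : s^*s\in\eta\}$ open. It is *effective* if the interior of $\{g : d(g)=r(g)\}$ is the set of units. **Theorem.** Suppose that $\mathcal G_{\mathrm{tight}}(\mathcal S_\Lambda)$ is Hausdorff or that $\hat{\mathcal E}_\infty=\hat{\mathcal E}_{\mathrm{tight}}$. Then the following are equivalent: 1. $\mathcal G_{\mathrm{tight}}(\mathcal S_\Lambda)$ is effective. 2. For every $s\in\mathcal S_\Lambda$ and every idempotent $e\in\mathcal E$ that is weakly fixed under $s$, there is a finite cover for $e$ consisting of idempotents that are fixed under $s$. 3. For all $\alpha,\beta\in\Lambda$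 with $r(\alpha)=r(\beta)$ and $s(\alpha)=s(\beta)$: if $\alpha\delta\Cap\beta\delta$ for every $\delta\in s(\alpha)\Lambda$, then there is a finite set $F\subseteq s(\alpha)\Lambda$ such that every $\delta\in s(\alpha)\Lambda$ satisfies $\gamma\Cap\delta$ for some $\gamma\in F$, and $\alpha\gamma=\beta\gamma$ for every $\gamma\in F$. -/

import Mathlib

open CategoryTheory

universe v u

/-! ## The symmetric inverse semigroup -/

/-- The symmetric inverse semigroup `I(X)`: bijections between subsets of `X`. -/
def PBij (X : Type u) : Type u := X ≃. X

namespace PBij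

variable {X : Type u}

/-- The graph of a partial bijection: `s.Rel a b` means that `a` is in the domain of `s` and
`s a = b`. -/
def Rel (s : PBij X) (a b : X) : Prop := b ∈ (show X ≃. X from s) a

/-- Product is composition of partial maps: `g * f` is "first `f`, then `g`", on the largest
possible domain. -/
instance : Mul (PBij X) := ⟨fun g f => PEquiv.trans f g⟩

/-- The involution is the inverse partial bijection. -/
instance : Inv (PBij X) := ⟨fun f => PEquiv.symm f⟩

/-- The zero is the empty map. -/
instance : Zero (PBij X) := ⟨(⊥ : X ≃. X)⟩

theorem ext_rel {s t : PBij X} (h : ∀ a b, s.Rel a b ↔ t.Rel a b) : s = t := by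
  refine PEquiv.ext fun a => Option.ext fun b => ?_
  exact h a b

theorem rel_mul {g f : PBij X} {a c : X} : (g * f).Rel a c ↔ ∃ b, f.Rel a b ∧ g.Rel b c :=
  PEquiv.mem_trans f g a c

theorem rel_inv {f : PBij X} {a b : X} : (f⁻¹).Rel a b ↔ f.Rel b a :=
  PEquiv.mem_iff_mem f

theorem rel_zero {a b : X} : ¬ (0 : PBij X).Rel a b := by
  intro h
  have h1 : b ∈ (none : Option X) := h
  simp at h1

theorem Rel.functional {f : PBij X} {a b c : X} (h : f.Rel a b) (h' : f.Rel a c) : b = c :=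
  Option.mem_unique h h'

theorem Rel.injective {f : PBij X} {a b c : X} (h : f.Rel a c) (h' : f.Rel b c) : a = b :=
  PEquiv.inj f h h'

instance : Semigroup (PBij X) where
  mul_assoc a b c := (PEquiv.trans_assoc (show X ≃. X from c) b a).symm

protected theorem mul_inv_rev (s t : PBij X) : (s * t)⁻¹ = t⁻¹ * s⁻¹ := rfl

protected theorem inv_inv (s : PBij X) : s⁻¹⁻¹ = s := rfl

theorem mul_inv_mul (s : PBij X) : s * s⁻¹ * s = s := by
  refine ext_rel fun a b => ?_
  simp only [rel_mul, rel_inv]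
  constructor
  · rintro ⟨c, h1, d, h2, h3⟩
    rwa [h1.injective h2]
  · intro h
    exact ⟨b, h, a, h, h⟩

/-- The partial bijection with a given graph. -/
noncomputable def ofRel (R : X → X → Prop) (hf : ∀ a b c, R a b → R a c → b = c)
    (hi : ∀ a b c, R a c → R b c → a = b) : PBij X :=
  open Classical in
  { toFun := fun a => if h : ∃ b, R a b then some h.choose else none
    invFun := fun b => if h : ∃ a, R a b then some h.choose else none
    inv := by
      classical
      intro a b
      have h1 : (if h : ∃ b, R a b then some h.choose else none) = some b ↔ R a b := by
        constructor
        · intro h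
          split_ifs at h with hb
          rw [← Option.some.inj h]
          exact hb.choose_spec
        · intro h
          have hb : ∃ b, R a b := ⟨b, h⟩
          rw [dif_pos hb, hf _ _ _ h hb.choose_spec]
      have h2 : (if h : ∃ a, R a b then some h.choose else none) = some a ↔ R a b := by
        constructor
        · intro h
          split_ifs at h with hb
          rw [← Option.some.inj h]
          exact hb.choose_spec
        · intro h
          have hb : ∃ a, R a b := ⟨a, h⟩
          rw [dif_pos hb, hi _ _ _ h hb.choose_spec]
      rw [h1, h2] }

theorem rel_ofRel {R : X → X → Prop} {hf hi} {a b : X} : (ofRel R hf hi).Rel a b ↔ R a b := by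
  classical
  change (if h : ∃ b, R a b then some h.choose else none) = some b ↔ R a b
  constructor
  · intro h
    split_ifs at h with hb
    rw [← Option.some.inj h]
    exact hb.choose_spec
  · intro h
    have hb : ∃ b, R a b := ⟨b, h⟩
    rw [dif_pos hb, hf _ _ _ h hb.choose_spec]

/-- The order on idempotents: `e ≤ f` if and only if `e = e f`. -/
def IdemLE (e f : PBij X) : Prop := e = e * f

theorem idem_iff {e : PBij X} : e * e = e ↔ ∀ a b, e.Rel a b → a = b := by
  constructor
  · intro h a b hab
    rw [← h, rel_mul] at hab
    obtain ⟨c, h1, h2⟩ := hab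
    have h3 : e.Rel a b := by rw [← h, rel_mul]; exact ⟨c, h1, h2⟩
    obtain rfl := h1.functional h3
    exact h3.injective h2
  · intro h
    refine ext_rel fun a b => ?_
    rw [rel_mul]
    constructor
    · rintro ⟨c, h1, h2⟩
      rwa [← h _ _ h2]
    · intro h1
      obtain rfl := h _ _ h1
      exact ⟨_, h1, h1⟩

theorem idemLE_iff {e f : PBij X} (he : e * e = e) (hf : f * f = f) :
    IdemLE e f ↔ ∀ a, e.Rel a a → f.Rel a a := by
  rw [idem_iff] at he hf
  constructor
  · intro h a ha
    rw [h, rel_mul] at ha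
    obtain ⟨b, h1, -⟩ := ha
    obtain rfl := hf _ _ h1
    exact h1
  · intro h
    refine ext_rel fun a b => ?_
    rw [rel_mul]
    constructor
    · intro h1
      obtain rfl := he _ _ h1
      exact ⟨_, h _ h1, h1⟩
    · rintro ⟨c, h1, h2⟩
      rwa [hf _ _ h1]

theorem idem_mul {e f : PBij X} (he : e * e = e) (hf : f * f = f) :
    (e * f) * (e * f) = e * f := by
  rw [idem_iff] at *
  intro a b h
  obtain ⟨c, h1, h2⟩ := rel_mul.1 h
  exact (hf _ _ h1).trans (he _ _ h2)

theorem rel_idem_mul {e f : PBij X} (_he : e * e = e) (hf : f * f = f) {a : X} :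
    (e * f).Rel a a ↔ e.Rel a a ∧ f.Rel a a := by
  rw [rel_mul]
  constructor
  · rintro ⟨b, h1, h2⟩
    obtain rfl := idem_iff.1 hf _ _ h1
    exact ⟨h2, h1⟩
  · rintro ⟨h1, h2⟩
    exact ⟨a, h2, h1⟩

theorem idem_comm {e f : PBij X} (he : e * e = e) (hf : f * f = f) : e * f = f * e := by
  refine ext_rel fun a b => ?_
  constructor
  · intro h
    obtain rfl := idem_iff.1 (idem_mul he hf) _ _ h
    exact (rel_idem_mul hf he).2 ((rel_idem_mul he hf).1 h).symm
  · intro h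
    obtain rfl := idem_iff.1 (idem_mul hf he) _ _ h
    exact (rel_idem_mul he hf).2 ((rel_idem_mul hf he).1 h).symm

theorem idem_conj {e : PBij X} (he : e * e = e) (s : PBij X) :
    (s * e * s⁻¹) * (s * e * s⁻¹) = s * e * s⁻¹ := by
  rw [idem_iff] at *
  intro a b h
  obtain ⟨c, h1, h2⟩ := rel_mul.1 h
  obtain ⟨d, h3, h4⟩ := rel_mul.1 h2
  obtain rfl := he _ _ h3
  exact (rel_inv.1 h1).functional h4

theorem rel_conj {e : PBij X} (he : e * e = e) {s : PBij X} {b : X} :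
    (s * e * s⁻¹).Rel b b ↔ ∃ a, s.Rel a b ∧ e.Rel a a := by
  rw [rel_mul]
  constructor
  · rintro ⟨a, h1, h2⟩
    obtain ⟨d, h3, h4⟩ := rel_mul.1 h2
    obtain rfl := idem_iff.1 he _ _ h3
    exact ⟨a, h4, h3⟩
  · rintro ⟨a, h1, h2⟩
    exact ⟨a, rel_inv.2 h1, rel_mul.2 ⟨a, h2, h1⟩⟩

theorem inv_of_idem {e : PBij X} (he : e * e = e) : e⁻¹ = e := by
  rw [idem_iff] at he
  refine ext_rel fun a b => ?_
  rw [rel_inv]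
  constructor
  · intro h
    obtain rfl := he _ _ h
    exact h
  · intro h
    obtain rfl := he _ _ h
    exact h

theorem inv_mul_of_idem {e : PBij X} (he : e * e = e) : e⁻¹ * e = e := by
  rw [inv_of_idem he, he]

theorem idem_inv_mul (s : PBij X) : (s⁻¹ * s) * (s⁻¹ * s) = s⁻¹ * s := by
  rw [idem_iff]
  intro a b h
  obtain ⟨c, h1, h2⟩ := rel_mul.1 h
  exact h1.injective (rel_inv.1 h2)

theorem rel_inv_mul {s : PBij X} {a : X} : (s⁻¹ * s).Rel a a ↔ ∃ b, s.Rel a b := by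
  rw [rel_mul]
  constructor
  · rintro ⟨b, h, -⟩
    exact ⟨b, h⟩
  · rintro ⟨b, h⟩
    exact ⟨b, h, rel_inv.2 h⟩

theorem mul_inv_mul_comm {e : PBij X} (he : e * e = e) (u : PBij X) :
    u * u⁻¹ * e * u = e * u := by
  have h : (u * u⁻¹) * (u * u⁻¹) = u * u⁻¹ := idem_inv_mul u⁻¹
  rw [idem_comm h he, mul_assoc, mul_inv_mul]

end PBij

/-- An inverse semigroup of partial bijections of `X`: a set of partial bijections closed under
composition and inverses. -/
structure InverseSubsemigroup (X : Type u) extends Subsemigroup (PBij X) where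
  inv_mem' : ∀ s ∈ carrier, s⁻¹ ∈ carrier

namespace InverseSubsemigroup

variable {X : Type u}

instance : Membership (PBij X) (InverseSubsemigroup X) := ⟨fun S s => s ∈ S.carrier⟩

variable {S : InverseSubsemigroup X}

protected theorem mul_mem {s t : PBij X} (hs : s ∈ S) (ht : t ∈ S) : s * t ∈ S :=
  S.mul_mem' hs ht

protected theorem inv_mem {s : PBij X} (hs : s ∈ S) : s⁻¹ ∈ S := S.inv_mem' s hs

/-- The semilattice of idempotents of `S`. -/
def idem (S : InverseSubsemigroup X) : Set (PBij X) := {e | e ∈ S ∧ e * e = e}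

theorem mul_mem_idem {e f : PBij X} (he : e ∈ S.idem) (hf : f ∈ S.idem) : e * f ∈ S.idem :=
  ⟨S.mul_mem he.1 hf.1, PBij.idem_mul he.2 hf.2⟩

theorem conj_mem_idem {s e : PBij X} (hs : s ∈ S) (he : e ∈ S.idem) : s * e * s⁻¹ ∈ S.idem :=
  ⟨S.mul_mem (S.mul_mem hs he.1) (S.inv_mem hs), PBij.idem_conj he.2 s⟩

theorem inv_mul_mem_idem {s : PBij X} (hs : s ∈ S) : s⁻¹ * s ∈ S.idem :=
  ⟨S.mul_mem (S.inv_mem hs) hs, PBij.idem_inv_mul s⟩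

end InverseSubsemigroup

/-! ## Fixed and weakly fixed idempotents, covers -/

namespace InverseSubsemigroup

variable {X : Type u} (S : InverseSubsemigroup X)

/-- The idempotent `e` is fixed under `s`: `e ≤ s⁻¹ s` and `s e = e`. -/
def IsFixed (s e : PBij X) : Prop := e ∈ S.idem ∧ e.IdemLE (s⁻¹ * s) ∧ s * e = e

/-- The idempotent `e` is weakly fixed under `s`: `e ≤ s⁻¹ s` and `(s f s⁻¹) f ≠ 0` for every
non-zero idempotent `f ≤ e`. -/
def IsWeaklyFixed (s e : PBij X) : Prop :=
  e ∈ S.idem ∧ e.IdemLE (s⁻¹ * s) ∧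
    ∀ f ∈ S.idem, f ≠ 0 → f.IdemLE e → s * f * s⁻¹ * f ≠ 0

/-- `Z` is a cover for the idempotent `e`: it consists of idempotents below `e`, and every
non-zero idempotent below `e` has non-zero product with some element of `Z`. -/
def IsCover (e : PBij X) (Z : Set (PBij X)) : Prop :=
  (∀ z ∈ Z, z ∈ S.idem ∧ z.IdemLE e) ∧
    ∀ f ∈ S.idem, f ≠ 0 → f.IdemLE e → ∃ z ∈ Z, z * f ≠ 0

/-! ## Filters, ultrafilters and tight filters -/

/-- A (proper) filter of idempotents of `S`. -/
structure IsIdemFilter (η : Set (PBij X)) : Prop where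
  subset : η ⊆ S.idem
  nonempty : η.Nonempty
  zero_notMem : (0 : PBij X) ∉ η
  upward : ∀ e ∈ η, ∀ f ∈ S.idem, e.IdemLE f → f ∈ η
  mul_mem : ∀ e ∈ η, ∀ f ∈ η, e * f ∈ η

/-- The space of filters of idempotents of `S`. -/
abbrev FilterSpace : Type u := {η : Set (PBij X) // S.IsIdemFilter η}

variable {S}

/-- The basic open sets `{η | A ⊆ η and B ∩ η = ∅}`. -/
def basicOpen (A B : Set (PBij X)) : Set S.FilterSpace := {η | A ⊆ η.1 ∧ B ∩ η.1 = ∅}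

/-- The topology whose basic open sets are the `basicOpen A B` with `A`, `B` finite sets of
idempotents (they are closed under finite intersections). -/
instance : TopologicalSpace S.FilterSpace :=
  TopologicalSpace.generateFrom
    {U | ∃ A B : Set (PBij X), A.Finite ∧ B.Finite ∧ A ⊆ S.idem ∧ B ⊆ S.idem ∧
      U = basicOpen A B}

variable (S)

/-- The set of ultrafilters, i.e. of maximal filters. -/
def ultrafilters : Set S.FilterSpace := {η | Maximal S.IsIdemFilter η.1}

/-- The set of tight filters: the closure of the set of ultrafilters. -/
def tightFilters : Set S.FilterSpace := closure S.ultrafilters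

/-- The space of tight filters, with the subspace topology. -/
def TightSpace : Type u := {η : S.FilterSpace // η ∈ S.tightFilters}

instance : TopologicalSpace S.TightSpace :=
  TopologicalSpace.induced (Subtype.val : {η : S.FilterSpace // η ∈ S.tightFilters} → S.FilterSpace)
    inferInstance

variable {S}

/-! ## The action of `S` on filters -/

/-- The underlying set of `s · η`: all idempotents above some `s e s⁻¹` with `e ∈ η`. -/
def actSet (S : InverseSubsemigroup X) (s : PBij X) (η : Set (PBij X)) : Set (PBij X) :=
  {f | f ∈ S.idem ∧ ∃ e ∈ η, (s * e * s⁻¹).IdemLE f}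

theorem mem_actSet_iff {s : PBij X} (hs : s ∈ S) {η : Set (PBij X)} (hη : S.IsIdemFilter η)
    (h : s⁻¹ * s ∈ η) {f : PBij X} :
    f ∈ actSet S s η ↔ f ∈ S.idem ∧ s⁻¹ * f * s ∈ η := by
  constructor
  · rintro ⟨hf, e, he, hle⟩
    refine ⟨hf, ?_⟩
    have heS := hη.subset he
    have hse := S.conj_mem_idem hs heS
    have hconj : s⁻¹ * f * s ∈ S.idem := S.conj_mem_idem (S.inv_mem hs) hf
    refine hη.upward _ (hη.mul_mem _ h _ he) _ hconj ?_
    rw [PBij.idemLE_iff (PBij.idem_mul (hη.subset h).2 heS.2) hconj.2]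
    intro a ha
    rw [PBij.rel_idem_mul (hη.subset h).2 heS.2, PBij.rel_inv_mul] at ha
    obtain ⟨⟨b, hb⟩, ha⟩ := ha
    refine (PBij.rel_conj (s := s⁻¹) hf.2).2 ⟨b, PBij.rel_inv.2 hb, ?_⟩
    exact (PBij.idemLE_iff hse.2 hf.2).1 hle b ((PBij.rel_conj heS.2).2 ⟨a, hb, ha⟩)
  · rintro ⟨hf, hm⟩
    refine ⟨hf, _, hm, ?_⟩
    have hc := hη.subset hm
    rw [PBij.idemLE_iff (PBij.idem_conj hc.2 s) hf.2]
    intro b hb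
    obtain ⟨a, h1, h2⟩ := (PBij.rel_conj hc.2).1 hb
    obtain ⟨c, h3, h4⟩ := (PBij.rel_conj (s := s⁻¹) hf.2).1 h2
    rwa [h1.functional (PBij.rel_inv.1 h3)]

theorem isIdemFilter_actSet {s : PBij X} (hs : s ∈ S) {η : Set (PBij X)}
    (hη : S.IsIdemFilter η) (h : s⁻¹ * s ∈ η) : S.IsIdemFilter (actSet S s η) where
  subset := fun _ hf => hf.1
  nonempty := by
    have h1 := S.conj_mem_idem hs (hη.subset h)
    exact ⟨_, h1, _, h, (PBij.idemLE_iff h1.2 h1.2).2 fun _ => id⟩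
  zero_notMem := by
    intro h0
    have h1 := ((mem_actSet_iff hs hη h).1 h0).2
    have h2 : s⁻¹ * 0 * s = 0 := by
      refine PBij.ext_rel fun a b => ?_
      simp [PBij.rel_mul, PBij.rel_zero]
    rw [h2] at h1
    exact hη.zero_notMem h1
  upward := by
    rintro e ⟨he, e', he', hle⟩ f hf hef
    refine ⟨hf, e', he', ?_⟩
    have h1 := S.conj_mem_idem hs (hη.subset he')
    rw [PBij.idemLE_iff h1.2 he.2] at hle
    rw [PBij.idemLE_iff he.2 hf.2] at hef
    exact (PBij.idemLE_iff h1.2 hf.2).2 fun a ha => hef a (hle a ha)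
  mul_mem := by
    intro e he f hf
    rw [mem_actSet_iff hs hη h] at he hf ⊢
    refine ⟨S.mul_mem_idem he.1 hf.1, ?_⟩
    have hm := hη.mul_mem _ he.2 _ hf.2
    have hef := S.mul_mem_idem he.1 hf.1
    have hc : s⁻¹ * (e * f) * s ∈ S.idem := S.conj_mem_idem (S.inv_mem hs) hef
    refine hη.upward _ hm _ hc ?_
    rw [PBij.idemLE_iff (hη.subset hm).2 hc.2]
    intro a ha
    rw [PBij.rel_idem_mul (hη.subset he.2).2 (hη.subset hf.2).2] at ha
    obtain ⟨b, h1, h2⟩ := (PBij.rel_conj (s := s⁻¹) he.1.2).1 ha.1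
    obtain ⟨c, h3, h4⟩ := (PBij.rel_conj (s := s⁻¹) hf.1.2).1 ha.2
    obtain rfl := (PBij.rel_inv.1 h1).functional (PBij.rel_inv.1 h3)
    exact (PBij.rel_conj (s := s⁻¹) hef.2).2 ⟨b, h1, (PBij.rel_idem_mul he.1.2 hf.1.2).2 ⟨h2, h4⟩⟩

/-- The filter `s · η`, defined for `s⁻¹ s ∈ η`. -/
def act (s : PBij X) (hs : s ∈ S) (η : S.FilterSpace) (h : s⁻¹ * s ∈ η.1) : S.FilterSpace :=
  ⟨actSet S s η.1, isIdemFilter_actSet hs η.2 h⟩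

theorem mem_act {s : PBij X} {hs : s ∈ S} {η : S.FilterSpace} {h : s⁻¹ * s ∈ η.1}
    {f : PBij X} : f ∈ (act s hs η h).1 ↔ f ∈ S.idem ∧ s⁻¹ * f * s ∈ η.1 :=
  mem_actSet_iff hs η.2 h

theorem inv_mul_mem_act {s : PBij X} (hs : s ∈ S) {η : S.FilterSpace} (h : s⁻¹ * s ∈ η.1) :
    (s⁻¹)⁻¹ * s⁻¹ ∈ (act s hs η h).1 := by
  rw [mem_act]
  refine ⟨inv_mul_mem_idem (S.inv_mem hs), ?_⟩
  have h1 : s⁻¹ * (s⁻¹⁻¹ * s⁻¹) * s = s⁻¹ * s := by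
    rw [PBij.inv_inv, mul_assoc, PBij.mul_inv_mul]
  rwa [h1]

theorem act_inv_act {s : PBij X} (hs : s ∈ S) {η : S.FilterSpace} (h : s⁻¹ * s ∈ η.1) :
    act s⁻¹ (S.inv_mem hs) (act s hs η h) (inv_mul_mem_act hs h) = η := by
  refine Subtype.ext (Set.ext fun f => ?_)
  rw [mem_act, mem_act]
  constructor
  · rintro ⟨hf, -, h2⟩
    refine η.2.upward _ h2 _ hf ?_
    rw [PBij.idemLE_iff (η.2.subset h2).2 hf.2, PBij.inv_inv]
    intro a ha
    have hc := S.conj_mem_idem hs hf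
    obtain ⟨b, h3, h4⟩ := (PBij.rel_conj (s := s⁻¹) hc.2).1 ha
    obtain ⟨c, h5, h6⟩ := (PBij.rel_conj hf.2).1 h4
    rwa [(PBij.rel_inv.1 h3).injective h5]
  · intro hm
    have hf := η.2.subset hm
    have hc := S.conj_mem_idem hs hf
    have hcc : s⁻¹ * (s * f * s⁻¹) * s ∈ S.idem := S.conj_mem_idem (S.inv_mem hs) hc
    refine ⟨hf, hc, η.2.upward _ (η.2.mul_mem _ h _ hm) _ hcc ?_⟩
    change PBij.IdemLE (s⁻¹ * s * f) (s⁻¹ * (s * f * s⁻¹) * s)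
    rw [PBij.idemLE_iff (PBij.idem_mul (η.2.subset h).2 hf.2) hcc.2]
    intro a ha
    rw [PBij.rel_idem_mul (η.2.subset h).2 hf.2, PBij.rel_inv_mul] at ha
    obtain ⟨⟨b, hb⟩, ha⟩ := ha
    exact (PBij.rel_conj (s := s⁻¹) hc.2).2
      ⟨b, PBij.rel_inv.2 hb, (PBij.rel_conj hf.2).2 ⟨a, hb, ha⟩⟩

theorem mul_dom_mem {s t : PBij X} (hs : s ∈ S) {η : S.FilterSpace} (h : s⁻¹ * s ∈ η.1)
    (h' : t⁻¹ * t ∈ (act s hs η h).1) : (t * s)⁻¹ * (t * s) ∈ η.1 := by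
  have h1 := (mem_act.1 h').2
  rwa [PBij.mul_inv_rev, mul_assoc, ← mul_assoc t⁻¹, ← mul_assoc]

theorem act_mul {s t : PBij X} (hs : s ∈ S) (ht : t ∈ S) {η : S.FilterSpace}
    (h : s⁻¹ * s ∈ η.1) (h' : t⁻¹ * t ∈ (act s hs η h).1) :
    act (t * s) (S.mul_mem ht hs) η (mul_dom_mem hs h h') = act t ht (act s hs η h) h' := by
  refine Subtype.ext (Set.ext fun f => ?_)
  rw [mem_act, mem_act, mem_act]
  have h1 : (t * s)⁻¹ * f * (t * s) = s⁻¹ * (t⁻¹ * f * t) * s := by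
    rw [PBij.mul_inv_rev]
    simp only [mul_assoc]
  rw [h1]
  constructor
  · rintro ⟨hf, h2⟩
    exact ⟨hf, S.conj_mem_idem (S.inv_mem ht) hf, h2⟩
  · rintro ⟨hf, -, h2⟩
    exact ⟨hf, h2⟩

theorem act_mem_ultrafilters {s : PBij X} {hs : s ∈ S} {η : S.FilterSpace}
    {h : s⁻¹ * s ∈ η.1} (hη : η ∈ S.ultrafilters) : act s hs η h ∈ S.ultrafilters := by
  refine ⟨(act s hs η h).2, fun ζ hζ hle f hf => ?_⟩
  have hd : (s⁻¹)⁻¹ * s⁻¹ ∈ ζ := hle (inv_mul_mem_act hs h)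
  have hη' : η.1 ≤ (act s⁻¹ (S.inv_mem hs) ⟨ζ, hζ⟩ hd).1 := by
    intro e he
    have h1 : e ∈ (act s⁻¹ (S.inv_mem hs) (act s hs η h) (inv_mul_mem_act hs h)).1 := by
      rw [act_inv_act]; exact he
    rw [mem_act] at h1 ⊢
    exact ⟨h1.1, hle h1.2⟩
  have h2 := hη.2 (act s⁻¹ (S.inv_mem hs) ⟨ζ, hζ⟩ hd).2 hη'
  have h3 : f ∈ (act s⁻¹⁻¹ (S.inv_mem (S.inv_mem hs))
      (act s⁻¹ (S.inv_mem hs) ⟨ζ, hζ⟩ hd) (inv_mul_mem_act _ _)).1 := by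
    rw [act_inv_act]; exact hf
  rw [mem_act] at h3
  exact mem_act.2 ⟨h3.1, h2 h3.2⟩

theorem continuous_act (s : PBij X) (hs : s ∈ S) :
    Continuous fun η : {η : S.FilterSpace // s⁻¹ * s ∈ η.1} => act s hs η.1 η.2 := by
  refine continuous_generateFrom_iff.2 ?_
  rintro U ⟨A, B, hA, hB, hAS, hBS, rfl⟩
  have hconj : ∀ e ∈ S.idem, s⁻¹ * e * s ∈ S.idem := fun e he => S.conj_mem_idem (S.inv_mem hs) he
  have h1 : IsOpen (basicOpen ((fun e => s⁻¹ * e * s) '' A) ((fun e => s⁻¹ * e * s) '' B) :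
      Set S.FilterSpace) := by
    refine TopologicalSpace.isOpen_generateFrom_of_mem
      ⟨_, _, hA.image _, hB.image _, ?_, ?_, rfl⟩
    · rintro _ ⟨e, he, rfl⟩
      exact hconj e (hAS he)
    · rintro _ ⟨e, he, rfl⟩
      exact hconj e (hBS he)
  convert h1.preimage continuous_subtype_val using 1
  ext ⟨η, hη⟩
  simp only [basicOpen, Set.mem_preimage, Set.mem_ofPred_eq, Set.eq_empty_iff_forall_notMem,
    Set.subset_def, Set.mem_inter_iff, mem_act, Set.mem_image, not_and]
  constructor
  · rintro ⟨h2, h3⟩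
    refine ⟨?_, ?_⟩
    · rintro _ ⟨e, he, rfl⟩
      exact (h2 e he).2
    rintro _ ⟨e, he, rfl⟩ h4
    exact h3 e he (hBS he) h4
  · rintro ⟨h2, h3⟩
    exact ⟨fun e he => ⟨hAS he, h2 _ ⟨e, he, rfl⟩⟩, fun e he _ h4 => h3 _ ⟨e, he, rfl⟩ h4⟩

theorem isOpen_dom {e : PBij X} (he : e ∈ S.idem) :
    IsOpen {η : S.FilterSpace | e ∈ η.1} := by
  refine TopologicalSpace.isOpen_generateFrom_of_mem
    ⟨{e}, ∅, Set.finite_singleton e, Set.finite_empty, by simpa using he, by simp, ?_⟩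
  ext η
  simp [basicOpen]

theorem act_mem_tightFilters {s : PBij X} {hs : s ∈ S} {η : S.FilterSpace}
    {h : s⁻¹ * s ∈ η.1} (hη : η ∈ S.tightFilters) : act s hs η h ∈ S.tightFilters := by
  rw [tightFilters, mem_closure_iff] at hη ⊢
  intro O hO hmem
  obtain ⟨V, hV, hVO⟩ := isOpen_induced_iff.1 ((continuous_act s hs).isOpen_preimage O hO)
  have hηV : η ∈ V := by
    have h1 : (⟨η, h⟩ : {η : S.FilterSpace // s⁻¹ * s ∈ η.1}) ∈ Subtype.val ⁻¹' V := by
      rw [hVO]; exact hmem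
    exact h1
  obtain ⟨ζ, ⟨hζV, hζd⟩, hζu⟩ :=
    hη _ (hV.inter (isOpen_dom (S.inv_mul_mem_idem hs))) ⟨hηV, h⟩
  refine ⟨act s hs ζ hζd, ?_, act_mem_ultrafilters hζu⟩
  have h2 : (⟨ζ, hζd⟩ : {η : S.FilterSpace // s⁻¹ * s ∈ η.1}) ∈ Subtype.val ⁻¹' V := hζV
  rw [hVO] at h2
  exact h2

/-- The action of `S` on the space of tight filters. -/
def tightAct (s : PBij X) (hs : s ∈ S) (η : S.TightSpace) (h : s⁻¹ * s ∈ η.1.1) : S.TightSpace :=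
  ⟨act s hs η.1 h, act_mem_tightFilters η.2⟩

/-! ## The tight groupoid: germs of the action on tight filters -/

variable (S)

/-- A pair `(s, η)` with `s ∈ S` and `η` a tight filter in the domain of the action of `s`. -/
@[ext] structure PreGerm where
  elt : PBij X
  elt_mem : elt ∈ S
  pt : S.TightSpace
  dom_mem : elt⁻¹ * elt ∈ pt.1.1

variable {S}

/-- `(s, η) ∼ (t, ζ)` if and only if `η = ζ` and `s e = t e` for some idempotent `e` with
`e ∈ η`. -/
instance germSetoid (S : InverseSubsemigroup X) : Setoid S.PreGerm where
  r p q := p.pt = q.pt ∧ ∃ e ∈ S.idem, e ∈ p.pt.1.1 ∧ p.elt * e = q.elt * e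
  iseqv :=
    { refl := fun p => by
        obtain ⟨e, he⟩ := p.pt.1.2.nonempty
        exact ⟨rfl, e, p.pt.1.2.subset he, he, rfl⟩
      symm := by
        rintro p q ⟨h, e, he, hm, heq⟩
        exact ⟨h.symm, e, he, h ▸ hm, heq.symm⟩
      trans := by
        rintro p q r ⟨h, e, he, hm, heq⟩ ⟨h', e', he', hm', heq'⟩
        rw [← h] at hm'
        refine ⟨h.trans h', e * e', S.mul_mem_idem he he', p.pt.1.2.mul_mem _ hm _ hm', ?_⟩
        have hcomm : e * e' = e' * e := PBij.idem_comm he.2 he'.2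
        rw [← mul_assoc, heq, mul_assoc, hcomm, ← mul_assoc, heq', mul_assoc] }

/-- The arrow space of the tight groupoid of `S`: the germs `[s, η]`. -/
def Germ (S : InverseSubsemigroup X) : Type u := Quotient (germSetoid S)

namespace PreGerm

/-- The range `s · η` of a pair `(s, η)`. -/
def ran (p : S.PreGerm) : S.TightSpace := tightAct p.elt p.elt_mem p.pt p.dom_mem

theorem ran_eq {p q : S.PreGerm} (h : p ≈ q) : p.ran = q.ran := by
  obtain ⟨s, hs, η, hd⟩ := p
  obtain ⟨t, ht, η', hd'⟩ := q
  obtain ⟨h, e, he, hm, heq⟩ := h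
  obtain rfl : η = η' := h
  replace heq : s * e = t * e := heq
  have key : ∀ u, ∀ hu : u ∈ S, ∀ hud : u⁻¹ * u ∈ η.1.1, ∀ f,
      f ∈ (act u hu η.1 hud).1 ↔ f ∈ S.idem ∧ (u * e)⁻¹ * f * (u * e) ∈ η.1.1 := by
    intro u hu hud f
    rw [mem_act]
    refine and_congr_right fun hf => ?_
    have hc : u⁻¹ * f * u ∈ S.idem := S.conj_mem_idem (S.inv_mem hu) hf
    have hc' : (u * e)⁻¹ * f * (u * e) ∈ S.idem :=
      S.conj_mem_idem (S.inv_mem (S.mul_mem hu he.1)) hf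
    constructor
    · intro h1
      refine η.1.2.upward _ (η.1.2.mul_mem _ h1 _ hm) _ hc' ?_
      rw [PBij.idemLE_iff (PBij.idem_mul hc.2 he.2) hc'.2]
      intro a ha
      rw [PBij.rel_idem_mul hc.2 he.2] at ha
      obtain ⟨b, h2, h3⟩ := (PBij.rel_conj (s := u⁻¹) hf.2).1 ha.1
      exact (PBij.rel_conj (s := (u * e)⁻¹) hf.2).2
        ⟨b, PBij.rel_inv.2 (PBij.rel_mul.2 ⟨a, ha.2, PBij.rel_inv.1 h2⟩), h3⟩
    · intro h1
      refine η.1.2.upward _ h1 _ hc ?_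
      rw [PBij.idemLE_iff hc'.2 hc.2]
      intro a ha
      obtain ⟨b, h2, h3⟩ := (PBij.rel_conj (s := (u * e)⁻¹) hf.2).1 ha
      obtain ⟨c, h4, h5⟩ := PBij.rel_mul.1 (PBij.rel_inv.1 h2)
      obtain rfl := PBij.idem_iff.1 he.2 _ _ h4
      exact (PBij.rel_conj (s := u⁻¹) hf.2).2 ⟨b, PBij.rel_inv.2 h5, h3⟩
  refine Subtype.ext (Subtype.ext (Set.ext fun f => ?_))
  change f ∈ (act s hs η.1 hd).1 ↔ f ∈ (act t ht η.1 hd').1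
  rw [key, key, heq]

end PreGerm

namespace Germ

/-- The germ `[s, η]`. -/
def mk (s : PBij X) (hs : s ∈ S) (η : S.TightSpace) (h : s⁻¹ * s ∈ η.1.1) : S.Germ :=
  Quotient.mk (germSetoid S) ⟨s, hs, η, h⟩

/-- The domain map `d [s, η] = η`. -/
def dom : S.Germ → S.TightSpace := Quotient.lift PreGerm.pt fun _ _ h => h.1

/-- The range map `r [s, η] = s · η`. -/
def ran : S.Germ → S.TightSpace := Quotient.lift PreGerm.ran fun _ _ h => PreGerm.ran_eq h

theorem mk_eq_mk_iff {s t : PBij X} {hs : s ∈ S} {ht : t ∈ S} {η ζ : S.TightSpace}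
    {h : s⁻¹ * s ∈ η.1.1} {h' : t⁻¹ * t ∈ ζ.1.1} :
    mk s hs η h = mk t ht ζ h' ↔ η = ζ ∧ ∃ e ∈ S.idem, e ∈ η.1.1 ∧ s * e = t * e :=
  Quotient.eq (r := germSetoid S)

theorem ind {p : S.Germ → Prop} (hp : ∀ s hs η h, p (mk s hs η h)) (g : S.Germ) : p g :=
  Quotient.inductionOn g fun a => hp a.elt a.elt_mem a.pt a.dom_mem

/-- The unit at `η`: the germ `[e, η]` for any idempotent `e ∈ η`. -/
noncomputable def unit (η : S.TightSpace) : S.Germ :=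
  mk η.1.2.nonempty.some (η.1.2.subset η.1.2.nonempty.some_mem).1 η (by
    have h := η.1.2.nonempty.some_mem
    have hS := η.1.2.subset h
    rwa [PBij.inv_mul_of_idem hS.2])

theorem unit_eq {e : PBij X} (he : e ∈ S.idem) {η : S.TightSpace} (h : e ∈ η.1.1) :
    unit η = mk e he.1 η (by rwa [PBij.inv_mul_of_idem he.2]) := by
  have h1 := η.1.2.nonempty.some_mem
  have h2 := η.1.2.subset h1
  refine mk_eq_mk_iff.2 ⟨rfl, _, S.mul_mem_idem h2 he, η.1.2.mul_mem _ h1 _ h, ?_⟩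
  rw [← mul_assoc, h2.2, ← mul_assoc, ← PBij.idem_comm h2.2 he.2, mul_assoc, he.2]

/-- The product of germs `g h`, defined when `d(g) = r(h)`; see `mul_mk_mk` for the formula
`[s, t · η] [t, η] = [s t, η]`. -/
noncomputable def mul (g h : S.Germ) (hc : g.dom = h.ran) : S.Germ :=
  mk (g.out.elt * h.out.elt) (S.mul_mem g.out.elt_mem h.out.elt_mem) h.out.pt (by
    have h1 : g.out.pt = h.out.ran := by
      rw [← Quotient.out_eq g, ← Quotient.out_eq h] at hc
      exact hc
    have h2 := g.out.dom_mem
    rw [h1] at h2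
    exact mul_dom_mem h.out.elt_mem h.out.dom_mem h2)

theorem mul_dom_mem' {s t : PBij X} {hs : s ∈ S} {ht : t ∈ S} {η ζ : S.TightSpace}
    {h : s⁻¹ * s ∈ ζ.1.1} {h' : t⁻¹ * t ∈ η.1.1} (hc : (mk s hs ζ h).dom = (mk t ht η h').ran) :
    (s * t)⁻¹ * (s * t) ∈ η.1.1 := by
  have hc' : ζ = tightAct t ht η h' := hc
  rw [hc'] at h
  exact mul_dom_mem ht h' h

theorem mul_mk_mk {s t : PBij X} {hs : s ∈ S} {ht : t ∈ S} {η ζ : S.TightSpace}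
    {h : s⁻¹ * s ∈ ζ.1.1} {h' : t⁻¹ * t ∈ η.1.1} (hc : (mk s hs ζ h).dom = (mk t ht η h').ran) :
    mul (mk s hs ζ h) (mk t ht η h') hc = mk (s * t) (S.mul_mem hs ht) η (mul_dom_mem' hc) := by
  obtain ⟨h1, e, he, hm, h2⟩ := Quotient.mk_out (s := germSetoid S) ⟨s, hs, ζ, h⟩
  obtain ⟨h3, f, hf, hm', h4⟩ := Quotient.mk_out (s := germSetoid S) ⟨t, ht, η, h'⟩
  have hc' : ζ = tightAct t ht η h' := hc
  set s' := (mk s hs ζ h).out.elt with hs'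
  set t' := (mk t ht η h').out.elt with ht'
  have hsS : s' ∈ S := (mk s hs ζ h).out.elt_mem
  have htS : t' ∈ S := (mk t ht η h').out.elt_mem
  change s' * e = s * e at h2
  change t' * f = t * f at h4
  have h3' : (mk t ht η h').out.pt = η := h3
  have hm1 : e ∈ ζ.1.1 := by rw [h1] at hm; exact hm
  have hm2 : f ∈ η.1.1 := by rw [h3] at hm'; exact hm'
  rw [hc'] at hm1
  have hm3 : t⁻¹ * e * t ∈ η.1.1 := ((mem_actSet_iff ht η.1.2 h').1 hm1).2
  have key : ∀ a b : PBij X, a * b * ((b * f)⁻¹ * e * (b * f)) = a * e * (b * f) := by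
    intro a b
    have h5 : b * ((b * f)⁻¹ * e * (b * f)) = b * f * (b * f)⁻¹ * e * (b * f) := by
      refine PBij.ext_rel fun x y => ?_
      simp only [PBij.rel_mul, PBij.rel_inv]
      constructor
      · rintro ⟨z, ⟨w, hw, v, hv, u, hu, hu'⟩, hz⟩
        have hz' := PBij.idem_iff.1 hf.2 _ _ hu
        subst hz'
        exact ⟨w, hw, v, hv, z, ⟨z, hu, hu'⟩, z, hu, hz⟩
      · rintro ⟨w, hw, v, hv, z, hz, u, hu, hu'⟩
        have hz' := PBij.idem_iff.1 hf.2 _ _ hu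
        subst hz'
        exact ⟨z, ⟨w, hw, v, hv, hz⟩, hu'⟩
    rw [mul_assoc, h5, PBij.mul_inv_mul_comm he.2, ← mul_assoc]
  unfold mul
  refine mk_eq_mk_iff.2 ⟨h3', (t * f)⁻¹ * e * (t * f),
    S.conj_mem_idem (S.inv_mem (S.mul_mem ht hf.1)) he, ?_, ?_⟩
  · rw [h3']
    have hcS : (t * f)⁻¹ * e * (t * f) ∈ S.idem :=
      S.conj_mem_idem (S.inv_mem (S.mul_mem ht hf.1)) he
    have hcT := η.1.2.subset hm3
    refine η.1.2.upward _ (η.1.2.mul_mem _ hm3 _ hm2) _ hcS ?_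
    rw [PBij.idemLE_iff (PBij.idem_mul hcT.2 hf.2) hcS.2]
    intro a ha
    rw [PBij.rel_idem_mul hcT.2 hf.2] at ha
    obtain ⟨b, h6, h7⟩ := (PBij.rel_conj (s := t⁻¹) he.2).1 ha.1
    exact (PBij.rel_conj (s := (t * f)⁻¹) he.2).2
      ⟨b, PBij.rel_inv.2 (PBij.rel_mul.2 ⟨a, ha.2, PBij.rel_inv.1 h6⟩), h7⟩
  · rw [key, ← h4, key, ← h2]

/-- The inverse germ `[s, η]⁻¹ = [s⁻¹, s · η]`. -/
noncomputable def inv (g : S.Germ) : S.Germ :=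
  mk g.out.elt⁻¹ (S.inv_mem g.out.elt_mem) g.out.ran
    (inv_mul_mem_act g.out.elt_mem g.out.dom_mem)

theorem inv_mk {s : PBij X} {hs : s ∈ S} {η : S.TightSpace} {h : s⁻¹ * s ∈ η.1.1} :
    inv (mk s hs η h) = mk s⁻¹ (S.inv_mem hs) (tightAct s hs η h)
      (inv_mul_mem_act hs h) := by
  have h0 := Quotient.mk_out (s := germSetoid S) ⟨s, hs, η, h⟩
  have hr := PreGerm.ran_eq h0
  obtain ⟨h1, e, he, hm, h2⟩ := h0
  set s' := (mk s hs η h).out.elt with hs'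
  change s' * e = s * e at h2
  have hm1 : e ∈ η.1.1 := by rw [h1] at hm; exact hm
  have hr' : (mk s hs η h).out.ran = tightAct s hs η h := hr
  have hk : s * e * s⁻¹ ∈ (tightAct s hs η h).1.1 :=
    ⟨S.conj_mem_idem hs he, e, hm1, by
      have := (S.conj_mem_idem hs he).2
      exact (PBij.idemLE_iff this this).2 fun _ => id⟩
  have hse : s * e * s⁻¹ = (s * e) * (s * e)⁻¹ := by
    rw [PBij.mul_inv_rev, PBij.inv_of_idem he.2, ← mul_assoc, mul_assoc s e e, he.2]
  have key : ∀ a : PBij X, a⁻¹ * ((a * e) * (a * e)⁻¹) = (a * e)⁻¹ := by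
    intro a
    refine PBij.ext_rel fun x y => ?_
    simp only [PBij.rel_mul, PBij.rel_inv]
    constructor
    · rintro ⟨b, ⟨z, ⟨c, h3, h4⟩, d, h5, h6⟩, h7⟩
      have hd := PBij.idem_iff.1 he.2 _ _ h5
      subst hd
      have hc := PBij.idem_iff.1 he.2 _ _ h3
      subst hc
      obtain rfl := h7.injective h6
      exact ⟨_, h5, h4⟩
    · rintro ⟨c, h3, h4⟩
      have hc := PBij.idem_iff.1 he.2 _ _ h3
      subst hc
      exact ⟨x, ⟨y, ⟨y, h3, h4⟩, y, h3, h4⟩, h4⟩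
  unfold inv
  refine mk_eq_mk_iff.2 ⟨hr', s * e * s⁻¹, S.conj_mem_idem hs he, hr' ▸ hk, ?_⟩
  rw [hse, key, ← h2]
  exact key s'

theorem dom_mul (g h : S.Germ) (hc : g.dom = h.ran) : (mul g h hc).dom = h.dom := by
  induction g using ind with | hp s hs η hd =>
  induction h using ind with | hp t ht ζ hd' =>
  rw [mul_mk_mk]
  rfl

theorem ran_mul (g h : S.Germ) (hc : g.dom = h.ran) : (mul g h hc).ran = g.ran := by
  induction g using ind with | hp s hs η hd =>
  induction h using ind with | hp t ht ζ hd' =>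
  rw [mul_mk_mk]
  have hc' : η = tightAct t ht ζ hd' := hc
  subst hc'
  exact Subtype.ext (act_mul ht hs hd' hd)

theorem dom_inv (g : S.Germ) : (inv g).dom = g.ran := by
  induction g using ind with | hp s hs η hd =>
  rw [inv_mk]
  rfl

theorem ran_inv (g : S.Germ) : (inv g).ran = g.dom := by
  induction g using ind with | hp s hs η hd =>
  rw [inv_mk]
  exact Subtype.ext (act_inv_act hs hd)

theorem dom_unit (η : S.TightSpace) : (unit η).dom = η := rfl

theorem ran_unit (η : S.TightSpace) : (unit η).ran = η := by
  obtain ⟨e, h⟩ := η.1.2.nonempty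
  have he := η.1.2.subset h
  rw [unit_eq he h]
  refine Subtype.ext (Subtype.ext (Set.ext fun f => ?_))
  change f ∈ (act e he.1 η.1 (by rwa [PBij.inv_mul_of_idem he.2])).1 ↔ f ∈ η.1.1
  rw [mem_act, PBij.inv_of_idem he.2]
  constructor
  · rintro ⟨hf, h1⟩
    refine η.1.2.upward _ h1 _ hf ?_
    have h2 := S.mul_mem_idem (S.mul_mem_idem he hf) he
    rw [PBij.idemLE_iff h2.2 hf.2]
    intro a ha
    rw [PBij.rel_idem_mul (S.mul_mem_idem he hf).2 he.2, PBij.rel_idem_mul he.2 hf.2] at ha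
    exact ha.1.2
  · intro hf
    exact ⟨η.1.2.subset hf, η.1.2.mul_mem _ (η.1.2.mul_mem _ h _ hf) _ h⟩

theorem mul_assoc (g h k : S.Germ) (hc : g.dom = h.ran) (hc' : h.dom = k.ran) :
    mul (mul g h hc) k ((dom_mul g h hc).trans hc') =
      mul g (mul h k hc') (hc.trans (ran_mul h k hc').symm) := by
  induction g using ind with | hp s hs η hd =>
  induction h using ind with | hp t ht ζ hd' =>
  induction k using ind with | hp r hr ξ hd'' =>
  simp only [mul_mk_mk]
  have hξ := ξ.1.2.nonempty.some_mem
  exact mk_eq_mk_iff.2 ⟨rfl, _, ξ.1.2.subset hξ, hξ, by rw [_root_.mul_assoc s t r]⟩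

theorem unit_mul (g : S.Germ) : mul (unit g.ran) g (dom_unit _) = g := by
  induction g using ind with | hp s hs η hd =>
  have hη : (mk s hs η hd).ran = tightAct s hs η hd := rfl
  have h1 : s * s⁻¹ ∈ (tightAct s hs η hd).1.1 := by
    have h2 : (s⁻¹)⁻¹ * s⁻¹ ∈ (act s hs η.1 hd).1 := inv_mul_mem_act hs hd
    exact h2
  have h2 : s * s⁻¹ ∈ S.idem := (tightAct s hs η hd).1.2.subset h1
  simp only [hη, unit_eq h2 h1, mul_mk_mk, PBij.mul_inv_mul]

theorem mul_unit (g : S.Germ) : mul g (unit g.dom) (ran_unit _).symm = g := by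
  induction g using ind with | hp s hs η hd =>
  have hη : (mk s hs η hd).dom = η := rfl
  have h2 : s⁻¹ * s ∈ S.idem := S.inv_mul_mem_idem hs
  simp only [hη, unit_eq h2 hd, mul_mk_mk, ← _root_.mul_assoc, PBij.mul_inv_mul]

theorem inv_mul (g : S.Germ) : mul (inv g) g (dom_inv g) = unit g.dom := by
  induction g using ind with | hp s hs η hd =>
  have hη : (mk s hs η hd).dom = η := rfl
  simp only [hη, unit_eq (S.inv_mul_mem_idem hs) hd, inv_mk]
  exact mul_mk_mk _

theorem mul_inv (g : S.Germ) : mul g (inv g) (ran_inv g).symm = unit g.ran := by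
  induction g using ind with | hp s hs η hd =>
  have hη : (mk s hs η hd).ran = tightAct s hs η hd := rfl
  have h1 : s * s⁻¹ ∈ (tightAct s hs η hd).1.1 := by
    have h2 : (s⁻¹)⁻¹ * s⁻¹ ∈ (act s hs η.1 hd).1 := inv_mul_mem_act hs hd
    exact h2
  have h2 : s * s⁻¹ ∈ S.idem := (tightAct s hs η hd).1.2.subset h1
  simp only [hη, unit_eq h2 h1, inv_mk]
  exact mul_mk_mk _

end Germ

/-- The tight groupoid of `S`: its unit space is the space of tight filters and its arrows from
`η` to `ζ` are the germs `g` with `d(g) = η` and `r(g) = ζ`. -/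
noncomputable instance tightGroupoid (S : InverseSubsemigroup X) : Groupoid S.TightSpace where
  Hom η ζ := {g : S.Germ // g.dom = η ∧ g.ran = ζ}
  id η := ⟨Germ.unit η, Germ.dom_unit η, Germ.ran_unit η⟩
  comp f g := ⟨Germ.mul g.1 f.1 (g.2.1.trans f.2.2.symm),
    (Germ.dom_mul _ _ _).trans f.2.1, (Germ.ran_mul _ _ _).trans g.2.2⟩
  inv f := ⟨Germ.inv f.1, (Germ.dom_inv _).trans f.2.2, (Germ.ran_inv _).trans f.2.1⟩
  id_comp := by
    rintro _ _ ⟨f, rfl, rfl⟩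
    exact Subtype.ext (Germ.mul_unit f)
  comp_id := by
    rintro _ _ ⟨f, rfl, rfl⟩
    exact Subtype.ext (Germ.unit_mul f)
  assoc := by
    intro _ _ _ _ f g h
    exact Subtype.ext (Germ.mul_assoc h.1 g.1 f.1 (h.2.1.trans g.2.2.symm)
      (g.2.1.trans f.2.2.symm)).symm
  inv_comp := by
    rintro _ _ ⟨f, rfl, rfl⟩
    exact Subtype.ext (Germ.mul_inv f)
  comp_inv := by
    rintro _ _ ⟨f, rfl, rfl⟩
    exact Subtype.ext (Germ.inv_mul f)

/-- The set of germs `[s, η]` with `η ∈ U`. -/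
def Germ.slice (s : PBij X) (hs : s ∈ S) (U : Set S.TightSpace)
    (hU : ∀ η ∈ U, s⁻¹ * s ∈ η.1.1) : Set S.Germ :=
  {g | ∃ η, ∃ h : η ∈ U, g = Germ.mk s hs η (hU η h)}

/-- The topology of the tight groupoid, with the basis of the sets `{[s, η] | η ∈ U}`, where
`s ∈ S` and `U` is an open set of tight filters contained in the domain of the action of `s`. -/
instance : TopologicalSpace S.Germ :=
  TopologicalSpace.generateFrom
    {V | ∃ (s : PBij X) (hs : s ∈ S) (U : Set S.TightSpace) (hU : ∀ η ∈ U, s⁻¹ * s ∈ η.1.1),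
      IsOpen U ∧ V = Germ.slice s hs U hU}

/-- The tight groupoid of `S` is effective: the interior of its isotropy bundle
`{g | d(g) = r(g)}` is the set of its units. -/
def TightGroupoidIsEffective (S : InverseSubsemigroup X) : Prop :=
  interior {g : S.Germ | g.dom = g.ran} = {g : S.Germ | ∃ η : S.TightSpace, g = (𝟙 η : η ⟶ η).1}

end InverseSubsemigroup

/-! ## Left cancellative small categories -/

/-- A category is left cancellative if `α β = α γ` implies `β = γ`. The product `α β` of the
paths `α` and `β` with `s(α) = r(β)` is the composition "first `β`, then `α`", i.e. `β ≫ α`. -/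
class LeftCancellative (C : Type u) [Category.{v} C] : Prop where
  mono : ∀ {x y : C} (f : x ⟶ y), Mono f

namespace LCSC

/-- The set of all morphisms of the category. The source `s(α)` is `α.left`, the range `r(α)` is
`α.right`, and objects are identified with identity morphisms. -/
abbrev Mor (C : Type u) [Category.{v} C] : Type max u v := Quiver.Total C

variable {C : Type u} [Category.{v} C]

/-- The morphism `α` as an element of the set of all morphisms. -/
def path {x y : C} (α : x ⟶ y) : Mor C := ⟨x, y, α⟩

/-- The set `αΛ` of all products `α β`. -/
def ideal (α : Mor C) : Set (Mor C) := {γ | ∃ (w : C) (β : w ⟶ α.left), γ = path (β ≫ α.hom)}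

/-- `α` and `β` have a common extension: `αΛ ∩ βΛ` is non-empty. -/
def Meets (α β : Mor C) : Prop := (ideal α ∩ ideal β).Nonempty

/-- A category is finitely aligned if each `αΛ ∩ βΛ` is a finite union of sets `γΛ`. -/
def FinitelyAligned (C : Type u) [Category.{v} C] : Prop :=
  ∀ α β : Mor C, ∃ G : Set (Mor C), G.Finite ∧ ideal α ∩ ideal β = ⋃ γ ∈ G, ideal γ

/-- The collection `FE(α)` of the finite subsets of `r(α)Λ` that are exhaustive with respect to
`α`. -/
def FE (α : Mor C) : Set (Set (Mor C)) :=
  {F | F.Finite ∧ (∀ β ∈ F, β.right = α.right) ∧ ∀ γ ∈ ideal α, ∃ β ∈ F, Meets β γ}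

/-- The graph of the map `τ^α : s(α)Λ → αΛ`, `β ↦ α β`. -/
def TauRel (α β γ : Mor C) : Prop :=
  ∃ (w : C) (δ : w ⟶ α.left), β = path δ ∧ γ = path (δ ≫ α.hom)

/-- The partial bijection `τ^α : s(α)Λ → αΛ`, `β ↦ α β`. -/
noncomputable def tau [LeftCancellative C] (α : Mor C) : PBij (Mor C) :=
  PBij.ofRel (TauRel α)
    (by
      rintro β _ _ ⟨w, δ, rfl, rfl⟩ ⟨w', δ', h, rfl⟩
      cases h
      rfl)
    (by
      rintro _ _ γ ⟨w, δ, rfl, rfl⟩ ⟨w', δ', rfl, h⟩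
      simp only [path, Quiver.Total.mk.injEq, true_and] at h
      obtain ⟨rfl, h⟩ := h
      have := LeftCancellative.mono α.hom
      rw [(cancel_mono α.hom).1 (eq_of_heq h)])

/-- The partial bijection `σ^α : αΛ → s(α)Λ`, `α β ↦ β`. -/
noncomputable def sigma [LeftCancellative C] (α : Mor C) : PBij (Mor C) := (tau α)⁻¹

/-- The inverse semigroup `S_Λ`: the semigroup generated by all `σ^α` and `τ^α`. -/
noncomputable def semigroup (C : Type u) [Category.{v} C] [LeftCancellative C] :
    InverseSubsemigroup (Mor C) where
  toSubsemigroup := Subsemigroup.closure {s | ∃ α : Mor C, s = sigma α ∨ s = tau α}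
  inv_mem' := by
    intro s hs
    change s ∈ Subsemigroup.closure _ at hs
    change s⁻¹ ∈ Subsemigroup.closure _
    induction hs using Subsemigroup.closure_induction with
    | mem s hs =>
      obtain ⟨α, rfl | rfl⟩ := hs
      · exact Subsemigroup.subset_closure ⟨α, Or.inr rfl⟩
      · exact Subsemigroup.subset_closure ⟨α, Or.inl rfl⟩
    | mul s t _ _ hs ht => exact Subsemigroup.mul_mem _ ht hs

end LCSC

/-! ### Idempotents as subsets, with product as intersection -/

namespace PBij

variable {X : Type u}

/-! The equivalence of 1 and 2 concerns any inverse semigroup of partial bijections; only the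
equivalence of 2 and 3 uses the category.

For `e ≤ s⁻¹ s`, weak fixedness of `e` under `s` means that `s` fixes every ultrafilter containing
`e` (`IsWeaklyFixed.act_eq`, `isWeaklyFixed_of_forall_act_eq`). By continuity and density it then
fixes every tight filter containing `e`, so the germs of `s` over these filters form an open set of
isotropy. On the other hand, `[s, η]` is a unit exactly when `η` contains an idempotent fixed under
`s` (`Germ.mk_eq_unit_iff`). In an effective groupoid the fixed idempotents below `e` therefore give
an open cover of the tight filters containing `e`; these form a compact set, and a finite subcover
is the required cover of `e`.

Conversely, take a germ `[s, η]` in the interior of the isotropy with `η` an ultrafilter.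
Neighbourhoods of an ultrafilter are controlled by a single idempotent
(`exists_mem_forall_mem_basicOpen`), and this idempotent, cut down to the domain of `s`, is weakly
fixed. A tight filter meets every finite cover of its elements (`exists_mem_of_isCover`), so `η`
contains a fixed idempotent and the germ is a unit. The disjunctive hypothesis deals with the other
tight filters: either there are none, or the groupoid is Hausdorff, the non-units are open, and
density moves a bad germ to an ultrafilter.

For 2 and 3, finite alignment makes every element of the semigroup a finite join of maps `τ^β σ^α`
(`isFiniteJoin_of_mem`). Hence semigroup elements commute with right multiplication, and the domain
of an idempotent is a finite union of sets `aΛ`. If `s` sends a generator `a` to `b`, weak fixedness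
says that `aδ` and `bδ` always have a common extension, while each `γ` with `aγ = bγ` yields a fixed
idempotent with domain `aγΛ`. Finite exhaustive sets of such `γ` thus correspond to finite covers by
fixed idempotents. -/

theorem ne_zero_iff {s : PBij X} : s ≠ 0 ↔ ∃ a b, s.Rel a b := by
  constructor
  · intro h
    by_contra! hc
    exact h (ext_rel fun a b => ⟨fun h1 => (hc a b h1).elim, fun h1 => (rel_zero h1).elim⟩)
  · rintro ⟨a, b, h⟩ rfl
    exact rel_zero h

theorem idem_ne_zero_iff {e : PBij X} (he : e * e = e) : e ≠ 0 ↔ ∃ a, e.Rel a a := by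
  rw [ne_zero_iff]
  constructor
  · rintro ⟨a, b, h⟩
    obtain rfl := idem_iff.1 he _ _ h
    exact ⟨a, h⟩
  · rintro ⟨a, h⟩
    exact ⟨a, a, h⟩

/-- The product of two idempotents is non-zero if and only if their domains meet. -/
theorem idem_mul_ne_zero_iff {e f : PBij X} (he : e * e = e) (hf : f * f = f) :
    e * f ≠ 0 ↔ ∃ a, e.Rel a a ∧ f.Rel a a := by
  rw [idem_ne_zero_iff (idem_mul he hf)]
  exact exists_congr fun a => rel_idem_mul he hf

theorem mul_idem_eq_iff {s e : PBij X} (he : e * e = e) :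
    s * e = e ↔ ∀ a, e.Rel a a → s.Rel a a := by
  constructor
  · intro h a ha
    have h1 := ha
    rw [← h] at h1
    obtain ⟨b, h2, h3⟩ := rel_mul.1 h1
    obtain rfl := idem_iff.1 he _ _ h2
    exact h3
  · intro h
    refine ext_rel fun a b => ?_
    rw [rel_mul]
    constructor
    · rintro ⟨c, h1, h2⟩
      obtain rfl := idem_iff.1 he _ _ h1
      obtain rfl := (h _ h1).functional h2
      exact h1
    · intro h1
      obtain rfl := idem_iff.1 he _ _ h1
      exact ⟨_, h1, h _ h1⟩

end PBij

/-! ### Filters, ultrafilters and tight filters -/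

namespace InverseSubsemigroup

variable {X : Type u} {S : InverseSubsemigroup X}

theorem IsIdemFilter.mem_of_rel {η : Set (PBij X)} (hη : S.IsIdemFilter η) {e f : PBij X}
    (he : e ∈ η) (hf : f ∈ S.idem) (h : ∀ a, e.Rel a a → f.Rel a a) : f ∈ η :=
  hη.upward e he f hf ((PBij.idemLE_iff (hη.subset he).2 hf.2).2 h)

theorem IsIdemFilter.mul_mem_iff {η : Set (PBij X)} (hη : S.IsIdemFilter η) {e f : PBij X}
    (he : e ∈ S.idem) (hf : f ∈ S.idem) : e * f ∈ η ↔ e ∈ η ∧ f ∈ η := by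
  refine ⟨fun h => ⟨hη.mem_of_rel h he fun a ha => ?_, hη.mem_of_rel h hf fun a ha => ?_⟩,
    fun h => hη.mul_mem _ h.1 _ h.2⟩
  · exact ((PBij.rel_idem_mul he.2 hf.2).1 ha).1
  · exact ((PBij.rel_idem_mul he.2 hf.2).1 ha).2

theorem IsIdemFilter.ne_zero {η : Set (PBij X)} (hη : S.IsIdemFilter η) {e : PBij X}
    (he : e ∈ η) : e ≠ 0 := by
  rintro rfl
  exact hη.zero_notMem he

/-- The filter generated by the products of `f` with the elements of a filter. -/
theorem IsIdemFilter.extend {η : Set (PBij X)} (hη : S.IsIdemFilter η) {f : PBij X}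
    (hf : f ∈ S.idem) (h : ∀ g ∈ η, f * g ≠ 0) :
    S.IsIdemFilter {k | k ∈ S.idem ∧ ∃ g ∈ η, (f * g).IdemLE k} where
  subset := fun _ hk => hk.1
  nonempty := by
    obtain ⟨g, hg⟩ := hη.nonempty
    refine ⟨f, hf, g, hg, ?_⟩
    rw [PBij.idemLE_iff (PBij.idem_mul hf.2 (hη.subset hg).2) hf.2]
    exact fun a ha => ((PBij.rel_idem_mul hf.2 (hη.subset hg).2).1 ha).1
  zero_notMem := by
    rintro ⟨h0, g, hg, hle⟩
    obtain ⟨a, ha⟩ := (PBij.idem_mul_ne_zero_iff hf.2 (hη.subset hg).2).1 (h g hg)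
    rw [PBij.idemLE_iff (PBij.idem_mul hf.2 (hη.subset hg).2) h0.2] at hle
    exact PBij.rel_zero (hle a ((PBij.rel_idem_mul hf.2 (hη.subset hg).2).2 ha))
  upward := by
    rintro k ⟨hk, g, hg, hle⟩ l hl hkl
    refine ⟨hl, g, hg, ?_⟩
    have h1 := PBij.idem_mul hf.2 (hη.subset hg).2
    rw [PBij.idemLE_iff h1 hk.2] at hle
    rw [PBij.idemLE_iff hk.2 hl.2] at hkl
    exact (PBij.idemLE_iff h1 hl.2).2 fun a ha => hkl a (hle a ha)
  mul_mem := by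
    rintro k ⟨hk, g, hg, hle⟩ l ⟨hl, g', hg', hle'⟩
    have hgi := hη.subset hg
    have hgi' := hη.subset hg'
    refine ⟨S.mul_mem_idem hk hl, g * g', hη.mul_mem _ hg _ hg', ?_⟩
    rw [PBij.idemLE_iff (PBij.idem_mul hf.2 hgi.2) hk.2] at hle
    rw [PBij.idemLE_iff (PBij.idem_mul hf.2 hgi'.2) hl.2] at hle'
    rw [PBij.idemLE_iff (PBij.idem_mul hf.2 (PBij.idem_mul hgi.2 hgi'.2))
      (PBij.idem_mul hk.2 hl.2)]
    intro a ha
    rw [PBij.rel_idem_mul hf.2 (PBij.idem_mul hgi.2 hgi'.2), PBij.rel_idem_mul hgi.2 hgi'.2] at ha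
    rw [PBij.rel_idem_mul hk.2 hl.2]
    exact ⟨hle a ((PBij.rel_idem_mul hf.2 hgi.2).2 ⟨ha.1, ha.2.1⟩),
      hle' a ((PBij.rel_idem_mul hf.2 hgi'.2).2 ⟨ha.1, ha.2.2⟩)⟩

/-- An ultrafilter contains every idempotent that meets all its elements. -/
theorem mem_of_mem_ultrafilters {η : S.FilterSpace} (hη : η ∈ S.ultrafilters) {f : PBij X}
    (hf : f ∈ S.idem) (h : ∀ g ∈ η.1, f * g ≠ 0) : f ∈ η.1 := by
  -- The filter generated by `f` and `η` contains `η`, so by maximality it adds nothing.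
  refine hη.2 (hη.1.extend hf h) (fun g hg => ?_) ?_
  · have hgi := hη.1.subset hg
    refine ⟨hgi, g, hg, ?_⟩
    rw [PBij.idemLE_iff (PBij.idem_mul hf.2 hgi.2) hgi.2]
    exact fun a ha => ((PBij.rel_idem_mul hf.2 hgi.2).1 ha).2
  · obtain ⟨g, hg⟩ := hη.1.nonempty
    have hgi := hη.1.subset hg
    refine ⟨hf, g, hg, ?_⟩
    rw [PBij.idemLE_iff (PBij.idem_mul hf.2 hgi.2) hf.2]
    exact fun a ha => ((PBij.rel_idem_mul hf.2 hgi.2).1 ha).1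

/-- The principal filter of a non-zero idempotent. -/
theorem isIdemFilter_principal {e : PBij X} (he : e ∈ S.idem) (h0 : e ≠ 0) :
    S.IsIdemFilter {f | f ∈ S.idem ∧ ∀ a, e.Rel a a → f.Rel a a} where
  subset := fun _ hk => hk.1
  nonempty := ⟨e, he, fun _ => id⟩
  zero_notMem := by
    rintro ⟨-, h⟩
    obtain ⟨a, ha⟩ := (PBij.idem_ne_zero_iff he.2).1 h0
    exact PBij.rel_zero (h a ha)
  upward := fun k hk l hl hkl =>
    ⟨hl, fun a ha => (PBij.idemLE_iff hk.1.2 hl.2).1 hkl a (hk.2 a ha)⟩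
  mul_mem := fun k hk l hl =>
    ⟨S.mul_mem_idem hk.1 hl.1,
      fun a ha => (PBij.rel_idem_mul hk.1.2 hl.1.2).2 ⟨hk.2 a ha, hl.2 a ha⟩⟩

/-- Every non-zero idempotent belongs to an ultrafilter. -/
theorem exists_mem_ultrafilters {e : PBij X} (he : e ∈ S.idem) (h0 : e ≠ 0) :
    ∃ η ∈ S.ultrafilters, e ∈ η.1 := by
  obtain ⟨η, hle, hη⟩ := zorn_subset_nonempty {η | S.IsIdemFilter η} (by
    rintro c hc hchain ⟨η₀, hη₀⟩
    refine ⟨⋃₀ c, ⟨?_, ?_, ?_, ?_, ?_⟩, fun η hη => Set.subset_sUnion_of_mem hη⟩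
    · rintro f ⟨η, hη, hf⟩
      exact (hc hη).subset hf
    · obtain ⟨f, hf⟩ := (hc hη₀).nonempty
      exact ⟨f, η₀, hη₀, hf⟩
    · rintro ⟨η, hη, hf⟩
      exact (hc hη).zero_notMem hf
    · rintro f ⟨η, hη, hf⟩ k hk hfk
      exact ⟨η, hη, (hc hη).upward f hf k hk hfk⟩
    · rintro f ⟨η, hη, hf⟩ k ⟨ζ, hζ, hk⟩
      rcases hchain.total hη hζ with h | h
      · exact ⟨ζ, hζ, (hc hζ).mul_mem _ (h hf) _ hk⟩
      · exact ⟨η, hη, (hc hη).mul_mem _ hf _ (h hk)⟩) _ (isIdemFilter_principal he h0)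
  exact ⟨⟨η, hη.1⟩, hη, hle ⟨he, fun _ => id⟩⟩

/-- A basic neighbourhood of an ultrafilter contains a neighbourhood given by one idempotent. -/
theorem exists_mem_forall_mem_basicOpen {η : S.FilterSpace} (hη : η ∈ S.ultrafilters)
    {U : Set S.FilterSpace} (hU : IsOpen U) (h : η ∈ U) :
    ∃ e ∈ η.1, ∀ ζ : S.FilterSpace, e ∈ ζ.1 → ζ ∈ U := by
  -- Finitely many conditions are merged into one idempotent by taking products.
  have hmul : ∀ e ∈ η.1, ∀ f ∈ η.1, ∀ ζ : S.FilterSpace, e * f ∈ ζ.1 → e ∈ ζ.1 ∧ f ∈ ζ.1 :=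
    fun e he f hf ζ hζ => (ζ.2.mul_mem_iff (η.2.subset he) (η.2.subset hf)).1 hζ
  induction hU with
  | basic U hU =>
    obtain ⟨A, B, hA, hB, -, hBS, rfl⟩ := hU
    obtain ⟨hAη, hBη⟩ := h
    have h1 : ∃ e ∈ η.1, ∀ ζ : S.FilterSpace, e ∈ ζ.1 → A ⊆ ζ.1 := by
      induction A, hA using Set.Finite.induction_on with
      | empty =>
        obtain ⟨e, he⟩ := η.2.nonempty
        exact ⟨e, he, fun ζ _ => Set.empty_subset _⟩
      | @insert a A _ _ ih =>
        obtain ⟨e, he, h1⟩ := ih ((Set.subset_insert _ _).trans hAη)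
        have ha := hAη (Set.mem_insert a A)
        refine ⟨a * e, η.2.mul_mem _ ha _ he, fun ζ hζ => ?_⟩
        obtain ⟨h2, h3⟩ := hmul a ha e he ζ hζ
        exact Set.insert_subset h2 (h1 ζ h3)
    have h2 : ∃ e ∈ η.1, ∀ ζ : S.FilterSpace, e ∈ ζ.1 → B ∩ ζ.1 = ∅ := by
      induction B, hB using Set.Finite.induction_on with
      | empty =>
        obtain ⟨e, he⟩ := η.2.nonempty
        exact ⟨e, he, fun ζ _ => Set.empty_inter _⟩
      | @insert b B _ _ ih =>
        rw [Set.eq_empty_iff_forall_notMem] at hBη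
        obtain ⟨e, he, h1⟩ := ih ((Set.subset_insert _ _).trans hBS)
          (Set.eq_empty_iff_forall_notMem.2 fun x hx => hBη x ⟨Set.mem_insert_of_mem b hx.1, hx.2⟩)
        have hb : b ∉ η.1 := fun hb => hBη b ⟨Set.mem_insert b B, hb⟩
        have hbS := hBS (Set.mem_insert b B)
        -- This is where maximality enters: not containing `b` is witnessed by containing some `g`
        -- disjoint from `b`, so an exclusion becomes an inclusion.
        obtain ⟨g, hg, hbg⟩ : ∃ g ∈ η.1, b * g = 0 := by
          by_contra! hc
          exact hb (mem_of_mem_ultrafilters hη hbS hc)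
        refine ⟨g * e, η.2.mul_mem _ hg _ he, fun ζ hζ => ?_⟩
        obtain ⟨h2, h3⟩ := hmul g hg e he ζ hζ
        rw [Set.insert_inter_of_notMem, h1 ζ h3]
        intro hbζ
        exact ζ.2.ne_zero (ζ.2.mul_mem _ hbζ _ h2) hbg
    obtain ⟨e, he, h1⟩ := h1
    obtain ⟨f, hf, h2⟩ := h2
    refine ⟨e * f, η.2.mul_mem _ he _ hf, fun ζ hζ => ?_⟩
    obtain ⟨h3, h4⟩ := hmul e he f hf ζ hζ
    exact ⟨h1 ζ h3, h2 ζ h4⟩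
  | univ =>
    obtain ⟨e, he⟩ := η.2.nonempty
    exact ⟨e, he, fun ζ _ => trivial⟩
  | inter U V _ _ ihU ihV =>
    obtain ⟨e, he, h1⟩ := ihU h.1
    obtain ⟨f, hf, h2⟩ := ihV h.2
    refine ⟨e * f, η.2.mul_mem _ he _ hf, fun ζ hζ => ?_⟩
    obtain ⟨h3, h4⟩ := hmul e he f hf ζ hζ
    exact ⟨h1 ζ h3, h2 ζ h4⟩
  | sUnion c _ ih =>
    obtain ⟨V, hV, hηV⟩ := h
    obtain ⟨e, he, h1⟩ := ih V hV hηV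
    exact ⟨e, he, fun ζ hζ => ⟨V, hV, h1 ζ hζ⟩⟩

theorem isOpen_notMem {e : PBij X} (he : e ∈ S.idem) : IsOpen {η : S.FilterSpace | e ∉ η.1} := by
  refine TopologicalSpace.isOpen_generateFrom_of_mem
    ⟨∅, {e}, Set.finite_empty, Set.finite_singleton e, by simp, by simpa using he, ?_⟩
  ext η
  simp [basicOpen]

/-- A tight filter meets every finite cover of each of its elements. -/
theorem exists_mem_of_isCover {η : S.FilterSpace} (hη : η ∈ S.tightFilters) {e : PBij X}
    (he : e ∈ η.1) {Z : Set (PBij X)} (hZ : S.IsCover e Z) (hfin : Z.Finite) :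
    ∃ z ∈ Z, z ∈ η.1 := by
  by_contra! hc
  have hopen : IsOpen (⋂ z ∈ Z, {ζ : S.FilterSpace | z ∉ ζ.1}) :=
    hfin.isOpen_biInter fun z hz => isOpen_notMem (hZ.1 z hz).1
  -- Missing the finite set `Z` is an open condition, so an ultrafilter `ζ` containing `e` misses
  -- `Z` too, and some `f ∈ ζ` forces this on every filter containing `f`. But some `z ∈ Z` meets `e
  -- * f`, and an ultrafilter through `z * (e * f)` contains both `f` and `z`.
  obtain ⟨ζ, ⟨hζ, heζ⟩, hζu⟩ := mem_closure_iff.1 hη _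
    (hopen.inter (isOpen_dom (η.2.subset he))) ⟨by simpa using hc, he⟩
  obtain ⟨f, hf, h1⟩ := exists_mem_forall_mem_basicOpen hζu hopen hζ
  have hef := ζ.2.mul_mem _ heζ _ hf
  have hei := ζ.2.subset heζ
  have hfi := ζ.2.subset hf
  have hefi := ζ.2.subset hef
  obtain ⟨z, hz, h2⟩ := hZ.2 (e * f) hefi (ζ.2.ne_zero hef)
    ((PBij.idemLE_iff hefi.2 hei.2).2 fun a ha => ((PBij.rel_idem_mul hei.2 hfi.2).1 ha).1)
  have hzi := (hZ.1 z hz).1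
  obtain ⟨ξ, -, hξ⟩ := exists_mem_ultrafilters (S.mul_mem_idem hzi hefi) h2
  rw [ξ.2.mul_mem_iff hzi hefi, ξ.2.mul_mem_iff hei hfi] at hξ
  have h3 := h1 ξ hξ.2.2
  rw [Set.mem_iInter₂] at h3
  exact h3 z hz hξ.1

/-! ### Separation and compactness of the filter spaces -/

instance : T2Space S.FilterSpace := by
  refine ⟨fun η ζ hne => ?_⟩
  have key : ∀ η ζ : S.FilterSpace, ∀ e ∈ η.1, e ∉ ζ.1 →
      ∃ U V : Set S.FilterSpace, IsOpen U ∧ IsOpen V ∧ η ∈ U ∧ ζ ∈ V ∧ Disjoint U V := by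
    intro η ζ e he hne
    have hei := η.2.subset he
    exact ⟨_, _, isOpen_dom hei, isOpen_notMem hei, he, hne,
      Set.disjoint_left.2 fun _ h1 h2 => h2 h1⟩
  by_cases h : η.1 ⊆ ζ.1
  · have h2 : ¬ ζ.1 ⊆ η.1 := fun h' => hne (Subtype.ext (h.antisymm h'))
    obtain ⟨e, he, hn⟩ := Set.not_subset.1 h2
    obtain ⟨U, V, hU, hV, h3, h4, hd⟩ := key ζ η e he hn
    exact ⟨V, U, hV, hU, h4, h3, hd.symm⟩
  · obtain ⟨e, he, hn⟩ := Set.not_subset.1 h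
    exact key η ζ e he hn

instance : T2Space S.TightSpace :=
  inferInstanceAs (T2Space {η : S.FilterSpace // η ∈ S.tightFilters})

/-- The filters that contain a given idempotent form a compact set. -/
theorem isCompact_dom {e : PBij X} (he : e ∈ S.idem) :
    IsCompact {η : S.FilterSpace | e ∈ η.1} := by
  rw [isCompact_iff_ultrafilter_le_nhds]
  intro 𝒰 h𝒰
  rw [Filter.le_principal_iff] at h𝒰
  -- The limit of `𝒰`: the idempotents contained in `𝒰`-almost every filter. The condition on `e`
  -- keeps this set non-empty, which is why compactness is local to the filters containing `e`.
  let ξ : Set (PBij X) := {f | f ∈ S.idem ∧ {η : S.FilterSpace | f ∈ η.1} ∈ 𝒰}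
  have hξ : S.IsIdemFilter ξ :=
    { subset := fun f hf => hf.1
      nonempty := ⟨e, he, h𝒰⟩
      zero_notMem := by
        rintro ⟨-, h⟩
        obtain ⟨η, hη⟩ := 𝒰.nonempty_of_mem h
        exact η.2.zero_notMem hη
      upward := fun f hf k hk hfk =>
        ⟨hk, Filter.mem_of_superset hf.2 fun η hη => η.2.upward f hη k hk hfk⟩
      mul_mem := fun f hf k hk =>
        ⟨S.mul_mem_idem hf.1 hk.1, Filter.mem_of_superset (Filter.inter_mem hf.2 hk.2)
          fun η hη => η.2.mul_mem f hη.1 k hη.2⟩ }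
  refine ⟨⟨ξ, hξ⟩, ⟨he, h𝒰⟩, ?_⟩
  rw [TopologicalSpace.nhds_generateFrom]
  refine le_iInf₂ fun U hU => ?_
  obtain ⟨hmem, A, B, hA, hB, hAS, hBS, rfl⟩ := hU
  rw [Filter.le_principal_iff]
  obtain ⟨h1, h2⟩ := hmem
  have h3 : (⋂ a ∈ A, {η : S.FilterSpace | a ∈ η.1}) ∈ 𝒰 :=
    (Filter.biInter_mem hA).2 fun a ha => (h1 ha).2
  have h4 : (⋂ b ∈ B, {η : S.FilterSpace | b ∈ η.1}ᶜ) ∈ 𝒰 := by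
    refine (Filter.biInter_mem hB).2 fun b hb => ?_
    refine Ultrafilter.compl_mem_iff_notMem.2 fun h5 => ?_
    exact Set.eq_empty_iff_forall_notMem.1 h2 b ⟨hb, hBS hb, h5⟩
  refine Filter.mem_of_superset (Filter.inter_mem h3 h4) ?_
  rintro η ⟨h5, h6⟩
  rw [Set.mem_iInter₂] at h5 h6
  exact ⟨fun a ha => h5 a ha, Set.eq_empty_iff_forall_notMem.2 fun b hb => h6 b hb.1 hb.2⟩

/-- The tight filters are closed by definition, so they cut out a closed part of a compact set. -/
theorem isCompact_tight_dom {e : PBij X} (he : e ∈ S.idem) :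
    IsCompact {η : S.TightSpace | e ∈ η.1.1} := by
  have h1 : IsCompact ({η : S.FilterSpace | e ∈ η.1} ∩ S.tightFilters) :=
    (isCompact_dom he).inter_right isClosed_closure
  have h2 : Topology.IsEmbedding (fun η : S.TightSpace => η.1) :=
    ⟨⟨rfl⟩, Subtype.val_injective⟩
  rw [h2.isCompact_iff]
  convert h1 using 1
  ext η
  constructor
  · rintro ⟨ζ, hζ, rfl⟩
    exact ⟨hζ, ζ.2⟩
  · rintro ⟨h, h'⟩
    exact ⟨⟨η, h'⟩, h, rfl⟩

end InverseSubsemigroup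

/-! ### The topology of the tight groupoid -/

namespace InverseSubsemigroup

variable {X : Type u} {S : InverseSubsemigroup X}

theorem isOpen_tight_dom {e : PBij X} (he : e ∈ S.idem) :
    IsOpen {η : S.TightSpace | e ∈ η.1.1} :=
  isOpen_induced_iff.2 ⟨_, isOpen_dom he, rfl⟩

/-- The ultrafilters are dense in the space of tight filters. -/
theorem exists_mem_ultrafilters_of_isOpen {U : Set S.TightSpace} (hU : IsOpen U)
    (hne : U.Nonempty) : ∃ η ∈ U, η.1 ∈ S.ultrafilters := by
  obtain ⟨V, hV, rfl⟩ := isOpen_induced_iff.1 hU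
  obtain ⟨η, hη⟩ := hne
  obtain ⟨ζ, hζV, hζ⟩ := mem_closure_iff.1 η.2 V hV hη
  exact ⟨⟨ζ, subset_closure hζ⟩, hζV, hζ⟩

namespace Germ

theorem mk_congr {s t e : PBij X} {hs : s ∈ S} {ht : t ∈ S} {η : S.TightSpace}
    {h : s⁻¹ * s ∈ η.1.1} {h' : t⁻¹ * t ∈ η.1.1} (he : e ∈ η.1.1) (heq : s * e = t * e) :
    mk s hs η h = mk t ht η h' :=
  mk_eq_mk_iff.2 ⟨rfl, e, η.1.2.subset he, he, heq⟩

theorem isOpen_slice {s : PBij X} (hs : s ∈ S) {U : Set S.TightSpace}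
    (hU : ∀ η ∈ U, s⁻¹ * s ∈ η.1.1) (h : IsOpen U) : IsOpen (slice s hs U hU) :=
  TopologicalSpace.isOpen_generateFrom_of_mem ⟨s, hs, U, hU, h, rfl⟩

/-- Every open set that contains `[s, η]` contains a slice of `s` through `η`. -/
theorem exists_isOpen_forall_mk_mem {V : Set S.Germ} (hV : IsOpen V) {s : PBij X} {hs : s ∈ S}
    {η : S.TightSpace} {h : s⁻¹ * s ∈ η.1.1} (hm : mk s hs η h ∈ V) :
    ∃ U : Set S.TightSpace, IsOpen U ∧ η ∈ U ∧ ∀ ζ ∈ U, ∀ h', mk s hs ζ h' ∈ V := by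
  induction hV with
  | basic V hV =>
    obtain ⟨t, ht, U, hU, hUo, rfl⟩ := hV
    obtain ⟨η', hη', heq⟩ := hm
    -- Since `s e = t e`, the germs of `s` and `t` agree at every filter of `U` that contains `e`.
    obtain ⟨rfl, e, he, heη, h1⟩ := mk_eq_mk_iff.1 heq
    refine ⟨_, hUo.inter (isOpen_tight_dom he), ⟨hη', heη⟩, ?_⟩
    rintro ζ ⟨hζ, heζ⟩ h'
    exact ⟨ζ, hζ, mk_congr heζ h1⟩
  | univ => exact ⟨Set.univ, isOpen_univ, trivial, fun _ _ _ => trivial⟩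
  | inter V W _ _ ihV ihW =>
    obtain ⟨U, hU, hηU, h1⟩ := ihV hm.1
    obtain ⟨U', hU', hηU', h2⟩ := ihW hm.2
    exact ⟨_, hU.inter hU', ⟨hηU, hηU'⟩, fun ζ hζ h' => ⟨h1 ζ hζ.1 h', h2 ζ hζ.2 h'⟩⟩
  | sUnion c _ ih =>
    obtain ⟨V, hV, hm⟩ := hm
    obtain ⟨U, hU, hηU, h1⟩ := ih V hV hm
    exact ⟨U, hU, hηU, fun ζ hζ h' => ⟨V, hV, h1 ζ hζ h'⟩⟩

theorem continuous_dom : Continuous (dom : S.Germ → S.TightSpace) := by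
  refine continuous_def.2 fun U hU => isOpen_iff_forall_mem_open.2 fun g hg => ?_
  induction g using ind with | hp s hs η h =>
  refine ⟨slice s hs (U ∩ {ζ | s⁻¹ * s ∈ ζ.1.1}) (fun ζ hζ => hζ.2), ?_,
    isOpen_slice _ _ (hU.inter (isOpen_tight_dom (S.inv_mul_mem_idem hs))), ⟨η, ⟨hg, h⟩, rfl⟩⟩
  rintro _ ⟨ζ, hζ, rfl⟩
  exact hζ.1

/-- One idempotent `e ∈ η` represents the units at all tight filters containing `e`, that is, on a
neighbourhood of `η`. -/
theorem continuous_unit : Continuous (unit : S.TightSpace → S.Germ) := by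
  refine continuous_def.2 fun V hV => isOpen_iff_forall_mem_open.2 fun η hη => ?_
  obtain ⟨e, he⟩ := η.1.2.nonempty
  have hei := η.1.2.subset he
  rw [Set.mem_preimage, unit_eq hei he] at hη
  obtain ⟨U, hU, hηU, h1⟩ := exists_isOpen_forall_mk_mem hV hη
  refine ⟨_, ?_, hU.inter (isOpen_tight_dom hei), ⟨hηU, he⟩⟩
  rintro ζ ⟨hζ, heζ⟩
  rw [Set.mem_preimage, unit_eq hei heζ]
  exact h1 ζ hζ _

/-- The germ `[s, η]` is a unit if and only if `s` fixes some element of `η`. -/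
theorem mk_eq_unit_iff {s : PBij X} {hs : s ∈ S} {η : S.TightSpace} {h : s⁻¹ * s ∈ η.1.1} :
    mk s hs η h = unit η ↔ ∃ e ∈ η.1.1, s * e = e := by
  constructor
  · intro heq
    rw [unit_eq (S.inv_mul_mem_idem hs) h] at heq
    obtain ⟨-, e, he, hm, h1⟩ := mk_eq_mk_iff.1 heq
    -- From `s e = s⁻¹ s e` it follows that `s (s⁻¹ s e) = s e = s⁻¹ s e`, so `s⁻¹ s e` is fixed.
    have h2 := η.1.2.mul_mem _ h _ hm
    refine ⟨_, h2, ?_⟩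
    rw [← _root_.mul_assoc, ← _root_.mul_assoc, PBij.mul_inv_mul, h1]
  · rintro ⟨e, he, h1⟩
    have hei := η.1.2.subset he
    rw [unit_eq hei he]
    exact mk_congr he (h1.trans hei.2.symm)

/-- The slice of an idempotent is open and consists of units. Effectiveness is thereby reduced to
the other inclusion. -/
theorem unit_mem_interior (η : S.TightSpace) :
    unit η ∈ interior {g : S.Germ | g.dom = g.ran} := by
  obtain ⟨e, he⟩ := η.1.2.nonempty
  have hei := η.1.2.subset he
  have hU : ∀ ζ ∈ {ζ : S.TightSpace | e ∈ ζ.1.1}, e⁻¹ * e ∈ ζ.1.1 := by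
    intro ζ hζ
    rwa [PBij.inv_mul_of_idem hei.2]
  refine mem_interior.2 ⟨slice e hei.1 _ hU, ?_, isOpen_slice _ _ (isOpen_tight_dom hei), ?_⟩
  · rintro _ ⟨ζ, hζ, rfl⟩
    rw [← unit_eq hei hζ]
    exact (ran_unit ζ).symm
  · exact ⟨η, he, unit_eq hei he⟩

end Germ

/-! ### Weakly fixed idempotents and effectiveness -/

theorem tightGroupoidIsEffective_iff :
    S.TightGroupoidIsEffective ↔
      ∀ g ∈ interior {g : S.Germ | g.dom = g.ran}, g = Germ.unit g.dom := by
  constructor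
  · intro h g hg
    rw [h] at hg
    obtain ⟨η, rfl⟩ := hg
    rfl
  · intro h
    refine Set.Subset.antisymm (fun g hg => ⟨g.dom, h g hg⟩) ?_
    rintro _ ⟨η, rfl⟩
    exact Germ.unit_mem_interior η

/-- An idempotent is weakly fixed if all ultrafilters that contain it are fixed points. -/
theorem isWeaklyFixed_of_forall_act_eq {s e : PBij X} (hs : s ∈ S) (he : e ∈ S.idem)
    (hle : e.IdemLE (s⁻¹ * s))
    (h : ∀ η ∈ S.ultrafilters, e ∈ η.1 → ∀ hd, act s hs η hd = η) : S.IsWeaklyFixed s e := by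
  refine ⟨he, hle, fun f hf h0 hfe => ?_⟩
  obtain ⟨η, hη, hfη⟩ := exists_mem_ultrafilters hf h0
  have heη := η.2.upward f hfη e he hfe
  have hd := η.2.upward e heη _ (S.inv_mul_mem_idem hs) hle
  have h1 : s * f * s⁻¹ ∈ η.1 := by
    have hc := S.conj_mem_idem hs hf
    rw [← h η hη heη hd]
    exact ⟨hc, f, hfη, (PBij.idemLE_iff hc.2 hc.2).2 fun _ => id⟩
  exact η.2.ne_zero (η.2.mul_mem _ h1 _ hfη)

/-- An ultrafilter that contains a weakly fixed idempotent is a fixed point. -/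
theorem IsWeaklyFixed.act_eq {s e : PBij X} (hs : s ∈ S) (h : S.IsWeaklyFixed s e)
    {η : S.FilterSpace} (hη : η ∈ S.ultrafilters) (he : e ∈ η.1) (hd : s⁻¹ * s ∈ η.1) :
    act s hs η hd = η := by
  -- One inclusion suffices, because `s · η` is again maximal. For it, `s f s⁻¹` has to meet every
  -- `g ∈ η`; weak fixedness is applied to the product `g f e`.
  have hle : (act s hs η hd).1 ⊆ η.1 := by
    rintro k ⟨hk, f, hf, hfk⟩
    have hfi := η.2.subset hf
    have hc := S.conj_mem_idem hs hfi
    refine η.2.upward _ (mem_of_mem_ultrafilters hη hc fun g hg => ?_) k hk hfk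
    have hgi := η.2.subset hg
    have hgf := η.2.mul_mem _ hg _ hf
    have hgfe := η.2.mul_mem _ hgf _ he
    have hgfi := η.2.subset hgf
    have hi := η.2.subset hgfe
    have h1 := h.2.2 _ hi (η.2.ne_zero hgfe) ((PBij.idemLE_iff hi.2 h.1.2).2 fun a ha =>
      ((PBij.rel_idem_mul hgfi.2 h.1.2).1 ha).2)
    rw [PBij.idem_mul_ne_zero_iff (S.conj_mem_idem hs hi).2 hi.2] at h1
    obtain ⟨a, ha, ha'⟩ := h1
    rw [PBij.rel_idem_mul hgfi.2 h.1.2, PBij.rel_idem_mul hgi.2 hfi.2] at ha'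
    obtain ⟨b, hb, hb'⟩ := (PBij.rel_conj hi.2).1 ha
    rw [PBij.rel_idem_mul hgfi.2 h.1.2, PBij.rel_idem_mul hgi.2 hfi.2] at hb'
    rw [PBij.idem_mul_ne_zero_iff hc.2 hgi.2]
    exact ⟨a, (PBij.rel_conj hfi.2).2 ⟨b, hb, hb'.1.2⟩, ha'.1.1⟩
  exact Subtype.ext (hle.antisymm ((act_mem_ultrafilters hη).2 η.2 hle))

/-- A tight filter that contains a weakly fixed idempotent is a fixed point. -/
theorem IsWeaklyFixed.act_eq_of_mem_tightFilters {s e : PBij X} (hs : s ∈ S)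
    (h : S.IsWeaklyFixed s e) {η : S.FilterSpace} (hη : η ∈ S.tightFilters) (he : e ∈ η.1)
    (hd : s⁻¹ * s ∈ η.1) : act s hs η hd = η := by
  by_contra hne
  -- In a Hausdorff space the non-fixed points are open, so a non-fixed tight filter containing `e`
  -- would produce a non-fixed ultrafilter containing `e`.
  have hopen : IsOpen {ζ : {ζ : S.FilterSpace // s⁻¹ * s ∈ ζ.1} | act s hs ζ.1 ζ.2 ≠ ζ.1} :=
    isOpen_ne_fun (continuous_act s hs) continuous_subtype_val
  obtain ⟨V, hV, hVeq⟩ := isOpen_induced_iff.1 hopen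
  have hηV : η ∈ V := by
    have h1 : (⟨η, hd⟩ : {ζ : S.FilterSpace // s⁻¹ * s ∈ ζ.1}) ∈ Subtype.val ⁻¹' V := by
      rw [hVeq]
      exact hne
    exact h1
  obtain ⟨ζ, ⟨hζV, heζ⟩, hζ⟩ := mem_closure_iff.1 hη _ (hV.inter (isOpen_dom h.1)) ⟨hηV, he⟩
  have hdζ := ζ.2.upward e heζ _ (S.inv_mul_mem_idem hs) h.2.1
  have h2 : (⟨ζ, hdζ⟩ : {ζ : S.FilterSpace // s⁻¹ * s ∈ ζ.1}) ∈ Subtype.val ⁻¹' V := hζV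
  rw [hVeq] at h2
  exact h2 (h.act_eq hs hζ heζ hdζ)

/-- If the tight groupoid is effective, then every weakly fixed idempotent has a finite cover
by fixed idempotents. -/
theorem TightGroupoidIsEffective.exists_cover (heff : S.TightGroupoidIsEffective) {s e : PBij X}
    (hs : s ∈ S) (h : S.IsWeaklyFixed s e) :
    ∃ Z : Set (PBij X), Z.Finite ∧ S.IsCover e Z ∧ ∀ z ∈ Z, S.IsFixed s z := by
  rw [tightGroupoidIsEffective_iff] at heff
  have hU : ∀ η ∈ {η : S.TightSpace | e ∈ η.1.1}, s⁻¹ * s ∈ η.1.1 := fun η hη =>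
    η.1.2.upward e hη _ (S.inv_mul_mem_idem hs) h.2.1
  have hfix : ∀ η : S.TightSpace, e ∈ η.1.1 →
      ∃ f ∈ η.1.1, f.IdemLE e ∧ s * f = f := by
    intro η hη
    -- The slice of `s` over the filters containing `e` is an open set of isotropy.
    have h1 : Germ.mk s hs η (hU η hη) ∈ interior {g : S.Germ | g.dom = g.ran} := by
      refine mem_interior.2 ⟨Germ.slice s hs _ hU, ?_,
        Germ.isOpen_slice _ _ (isOpen_tight_dom h.1), ⟨η, hη, rfl⟩⟩
      rintro _ ⟨ζ, hζ, rfl⟩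
      exact Subtype.ext (h.act_eq_of_mem_tightFilters hs ζ.2 hζ (hU ζ hζ)).symm
    obtain ⟨f, hf, h2⟩ := Germ.mk_eq_unit_iff.1 (heff _ h1)
    have hfi := η.1.2.subset hf
    have hfe := η.1.2.mul_mem _ hf _ hη
    refine ⟨f * e, hfe, (PBij.idemLE_iff (η.1.2.subset hfe).2 h.1.2).2 fun a ha => ?_, ?_⟩
    · exact ((PBij.rel_idem_mul hfi.2 h.1.2).1 ha).2
    · rw [← mul_assoc, h2]
  obtain ⟨T, hT, hTfin, hcover⟩ := (isCompact_tight_dom h.1).elim_finite_subcover_image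
    (b := {f | f ∈ S.idem ∧ f.IdemLE e ∧ s * f = f}) (c := fun f => {η : S.TightSpace | f ∈ η.1.1})
    (fun f hf => isOpen_tight_dom hf.1) (fun η hη => by
      obtain ⟨f, hf, h1⟩ := hfix η hη
      exact Set.mem_biUnion (show f ∈ _ from ⟨η.1.2.subset hf, h1⟩) hf)
  refine ⟨T, hTfin, ⟨fun z hz => ⟨(hT hz).1, (hT hz).2.1⟩, fun f hf h0 hfe => ?_⟩, fun z hz => ?_⟩
  · obtain ⟨η, hη, hfη⟩ := exists_mem_ultrafilters hf h0
    have h1 : (⟨η, subset_closure hη⟩ : S.TightSpace) ∈ {η : S.TightSpace | e ∈ η.1.1} :=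
      η.2.upward f hfη e h.1 hfe
    obtain ⟨z, hz, hzη⟩ := Set.mem_iUnion₂.1 (hcover h1)
    exact ⟨z, hz, η.2.ne_zero (η.2.mul_mem z hzη f hfη)⟩
  · obtain ⟨hzi, hze, hsz⟩ := hT hz
    refine ⟨hzi, ?_, hsz⟩
    rw [PBij.idemLE_iff hzi.2 (PBij.idem_inv_mul s)]
    exact fun a ha => PBij.rel_inv_mul.2 ⟨a, (PBij.mul_idem_eq_iff hzi.2).1 hsz a ha⟩

/-- If every weakly fixed idempotent has a finite cover by fixed idempotents, then a germ at an
ultrafilter that lies in the interior of the isotropy bundle is a unit. -/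
theorem mk_eq_unit_of_mem_interior
    (hcov : ∀ s ∈ S, ∀ e : PBij X, S.IsWeaklyFixed s e →
      ∃ Z : Set (PBij X), Z.Finite ∧ S.IsCover e Z ∧ ∀ z ∈ Z, S.IsFixed s z)
    {s : PBij X} {hs : s ∈ S} {η : S.TightSpace} {hd : s⁻¹ * s ∈ η.1.1}
    (hη : η.1 ∈ S.ultrafilters)
    (hg : Germ.mk s hs η hd ∈ interior {g : S.Germ | g.dom = g.ran}) :
    Germ.mk s hs η hd = Germ.unit η := by
  obtain ⟨U, hU, hηU, h1⟩ := Germ.exists_isOpen_forall_mk_mem isOpen_interior hg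
  obtain ⟨V, hV, rfl⟩ := isOpen_induced_iff.1 hU
  obtain ⟨e, he, h2⟩ := exists_mem_forall_mem_basicOpen hη hV hηU
  have hei := η.1.2.subset he
  have hse := η.1.2.mul_mem _ hd _ he
  have hdi := S.inv_mul_mem_idem hs
  have hsei := S.mul_mem_idem hdi hei
  -- Every filter containing `e` lies in `V`, where the germs of `s` are isotropy. The factor `s⁻¹
  -- s` puts the idempotent below the domain of `s`.
  have hwf : S.IsWeaklyFixed s (s⁻¹ * s * e) := by
    refine isWeaklyFixed_of_forall_act_eq hs hsei ?_ fun ζ hζ hm hdζ => ?_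
    · exact (PBij.idemLE_iff hsei.2 hdi.2).2 fun a ha => ((PBij.rel_idem_mul hdi.2 hei.2).1 ha).1
    · have h3 : ζ ∈ V := h2 ζ ((ζ.2.mul_mem_iff hdi hei).1 hm).2
      have h4 := interior_subset (h1 ⟨ζ, subset_closure hζ⟩ h3 hdζ)
      exact (congrArg Subtype.val h4).symm
  obtain ⟨Z, hZ, hZc, hZf⟩ := hcov s hs _ hwf
  obtain ⟨z, hz, hzη⟩ := exists_mem_of_isCover η.2 hse hZc hZ
  exact Germ.mk_eq_unit_iff.2 ⟨z, hzη, (hZf z hz).2.2⟩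

/-- If the tight groupoid is Hausdorff or all tight filters are ultrafilters, then it is effective
as soon as every weakly fixed idempotent has a finite cover by fixed idempotents. -/
theorem tightGroupoidIsEffective_of_exists_cover
    (h : T2Space S.Germ ∨ S.ultrafilters = S.tightFilters)
    (hcov : ∀ s ∈ S, ∀ e : PBij X, S.IsWeaklyFixed s e →
      ∃ Z : Set (PBij X), Z.Finite ∧ S.IsCover e Z ∧ ∀ z ∈ Z, S.IsFixed s z) :
    S.TightGroupoidIsEffective := by
  rw [tightGroupoidIsEffective_iff]
  intro g hg
  rcases h with hT | hu
  · by_contra hne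
    -- A non-unit differs from the unit at its domain, an open condition in a Hausdorff groupoid.
    -- Density of the ultrafilters then gives such a germ at an ultrafilter.
    have hopen : IsOpen (interior {g : S.Germ | g.dom = g.ran} ∩ {g | g ≠ Germ.unit g.dom}) :=
      isOpen_interior.inter
        (isOpen_ne_fun continuous_id (Germ.continuous_unit.comp Germ.continuous_dom))
    have hm : g ∈ interior {g : S.Germ | g.dom = g.ran} ∩ {g | g ≠ Germ.unit g.dom} := ⟨hg, hne⟩
    induction g using Germ.ind with | hp s hs η hd =>
    obtain ⟨U, hU, hηU, h1⟩ := Germ.exists_isOpen_forall_mk_mem hopen hm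
    obtain ⟨ζ, ⟨hζU, hdζ⟩, hζ⟩ := exists_mem_ultrafilters_of_isOpen
      (hU.inter (isOpen_tight_dom (S.inv_mul_mem_idem hs))) ⟨η, hηU, hd⟩
    obtain ⟨h2, h3⟩ := h1 ζ hζU hdζ
    exact h3 (mk_eq_unit_of_mem_interior hcov hζ h2)
  · induction g using Germ.ind with | hp s hs η hd =>
    exact mk_eq_unit_of_mem_interior hcov (by rw [hu]; exact η.2) hg

end InverseSubsemigroup

namespace LCSC

variable {C : Type u} [Category.{v} C]

/-! ### The partial product of morphisms -/

theorem path_comp_id {w x : C} (δ : w ⟶ x) : path (δ ≫ 𝟙 x) = path δ := by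
  rw [Category.comp_id]

theorem path_assoc {v w x y : C} (ε : v ⟶ w) (δ : w ⟶ x) (α : x ⟶ y) :
    path ((ε ≫ δ) ≫ α) = path (ε ≫ δ ≫ α) := by
  rw [Category.assoc]

theorem tauRel_path {w x y : C} (α : x ⟶ y) (δ : w ⟶ x) :
    TauRel (path α) (path δ) (path (δ ≫ α)) :=
  ⟨w, δ, rfl, rfl⟩

theorem tauRel_id (α : Mor C) : TauRel α (path (𝟙 α.left)) α :=
  ⟨_, 𝟙 α.left, rfl, by rw [Category.id_comp]; rfl⟩

theorem mem_ideal_iff {α γ : Mor C} : γ ∈ ideal α ↔ ∃ δ, TauRel α δ γ := by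
  constructor
  · rintro ⟨w, δ, rfl⟩
    exact ⟨_, w, δ, rfl, rfl⟩
  · rintro ⟨_, w, δ, rfl, rfl⟩
    exact ⟨w, δ, rfl⟩

theorem mem_ideal_self (α : Mor C) : α ∈ ideal α := mem_ideal_iff.2 ⟨_, tauRel_id α⟩

theorem TauRel.right_eq {α β γ : Mor C} (h : TauRel α β γ) : γ.right = α.right := by
  obtain ⟨w, δ, rfl, rfl⟩ := h
  rfl

theorem TauRel.left_eq {α β γ : Mor C} (h : TauRel α β γ) : γ.left = β.left := by
  obtain ⟨w, δ, rfl, rfl⟩ := h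
  rfl

theorem TauRel.middle_eq {α β γ : Mor C} (h : TauRel α β γ) : β.right = α.left := by
  obtain ⟨w, δ, rfl, rfl⟩ := h
  rfl

theorem exists_tauRel {α β : Mor C} (h : β.right = α.left) : ∃ γ, TauRel α β γ := by
  obtain ⟨x, y, a⟩ := α
  obtain ⟨w, x', b⟩ := β
  obtain rfl : x' = x := h
  exact ⟨_, tauRel_path a b⟩

theorem TauRel.functional {α β γ γ' : Mor C} (h : TauRel α β γ) (h' : TauRel α β γ') :
    γ = γ' := by
  obtain ⟨w, δ, rfl, rfl⟩ := h
  obtain ⟨w', δ', h, rfl⟩ := h'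
  cases h
  rfl

/-- `TauRel α β γ` reads `γ = αβ`. Treating the product as a relation on `Mor C` allows
associativity to be used without transporting morphisms along equalities of objects. -/
theorem TauRel.assoc {α δ x ε y : Mor C} (h : TauRel α δ x) (h' : TauRel x ε y) :
    ∃ ζ, TauRel δ ε ζ ∧ TauRel α ζ y := by
  obtain ⟨w, d, rfl, rfl⟩ := h
  obtain ⟨v, e, rfl, rfl⟩ := h'
  exact ⟨path (e ≫ d), ⟨v, e, rfl, rfl⟩, v, e ≫ d, rfl, (path_assoc e d α.hom).symm⟩

theorem TauRel.assoc' {α δ ζ ε y : Mor C} (h : TauRel δ ε ζ) (h' : TauRel α ζ y) :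
    ∃ x, TauRel α δ x ∧ TauRel x ε y := by
  obtain ⟨x, hx⟩ := exists_tauRel (h.right_eq.symm.trans h'.middle_eq)
  obtain ⟨y', hy'⟩ := exists_tauRel (h.middle_eq.trans hx.left_eq.symm)
  obtain ⟨ζ', h1, h2⟩ := hx.assoc hy'
  obtain rfl := h.functional h1
  obtain rfl := h'.functional h2
  exact ⟨x, hx, hy'⟩

theorem tauRel_id_left_iff {x : C} {β γ : Mor C} :
    TauRel (path (𝟙 x)) β γ ↔ β = γ ∧ β.right = x := by
  constructor
  · rintro ⟨w, δ, rfl, rfl⟩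
    exact ⟨(path_comp_id δ).symm, rfl⟩
  · rintro ⟨rfl, rfl⟩
    exact ⟨_, β.hom, rfl, (path_comp_id β.hom).symm⟩

theorem mem_ideal_trans {α β γ : Mor C} (h : β ∈ ideal α) (h' : γ ∈ ideal β) : γ ∈ ideal α := by
  rw [mem_ideal_iff] at *
  obtain ⟨δ, h⟩ := h
  obtain ⟨ε, h'⟩ := h'
  obtain ⟨ζ, -, h1⟩ := h.assoc h'
  exact ⟨ζ, h1⟩

theorem right_eq_of_mem_ideal {α γ : Mor C} (h : γ ∈ ideal α) : γ.right = α.right := by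
  obtain ⟨w, β, rfl⟩ := h
  rfl

/-- The right multiples of `a` by the elements of a finite set form a finite set. -/
theorem finite_setOf_tauRel (a : Mor C) {F : Set (Mor C)} (hF : F.Finite) :
    {κ | ∃ γ ∈ F, TauRel a γ κ}.Finite := by
  have h : {κ | ∃ γ ∈ F, TauRel a γ κ} = ⋃ γ ∈ F, {κ | TauRel a γ κ} := by
    ext κ
    simp
  rw [h]
  exact hF.biUnion fun γ _ => Set.Subsingleton.finite fun κ hκ κ' hκ' => hκ.functional hκ'

/-- The partial bijection `s` is the join of the maps `τ^β σ^α`, where `(α, β)` ranges over a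
finite set of pairs with `s(α) = s(β)`. -/
def IsFiniteJoin (s : PBij (Mor C)) : Prop :=
  ∃ P : Set (Mor C × Mor C), P.Finite ∧ (∀ p ∈ P, p.1.left = p.2.left) ∧
    ∀ x y, s.Rel x y ↔ ∃ p ∈ P, ∃ δ, TauRel p.1 δ x ∧ TauRel p.2 δ y

theorem IsFiniteJoin.inv {s : PBij (Mor C)} (h : IsFiniteJoin s) : IsFiniteJoin s⁻¹ := by
  obtain ⟨P, hP, hl, h⟩ := h
  refine ⟨Prod.swap '' P, hP.image _, ?_, fun x y => ?_⟩
  · rintro _ ⟨p, hp, rfl⟩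
    exact (hl p hp).symm
  · rw [PBij.rel_inv, h]
    constructor
    · rintro ⟨p, hp, δ, h1, h2⟩
      exact ⟨_, ⟨p, hp, rfl⟩, δ, h2, h1⟩
    · rintro ⟨_, ⟨p, hp, rfl⟩, δ, h1, h2⟩
      exact ⟨p, hp, δ, h2, h1⟩

variable [LeftCancellative C]

theorem rel_tau {α β γ : Mor C} : (tau α).Rel β γ ↔ TauRel α β γ := PBij.rel_ofRel

theorem rel_sigma {α β γ : Mor C} : (sigma α).Rel γ β ↔ TauRel α β γ :=
  PBij.rel_inv.trans rel_tau

theorem TauRel.cancel {α β β' γ : Mor C} (h : TauRel α β γ) (h' : TauRel α β' γ) : β = β' :=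
  (rel_tau.2 h).injective (rel_tau.2 h')

theorem tau_mem (α : Mor C) : tau α ∈ semigroup C :=
  Subsemigroup.subset_closure ⟨α, Or.inr rfl⟩

theorem sigma_mem (α : Mor C) : sigma α ∈ semigroup C :=
  Subsemigroup.subset_closure ⟨α, Or.inl rfl⟩

theorem rel_tau_mul_sigma {α β x y : Mor C} :
    (tau α * sigma β).Rel x y ↔ ∃ δ, TauRel β δ x ∧ TauRel α δ y := by
  rw [PBij.rel_mul]
  simp only [rel_tau, rel_sigma]

/-- The idempotent with domain `αΛ`. -/
noncomputable def proj (α : Mor C) : PBij (Mor C) := tau α * sigma α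

theorem proj_mem_idem (α : Mor C) : proj α ∈ (semigroup C).idem := by
  refine ⟨(semigroup C).mul_mem (tau_mem α) (sigma_mem α), PBij.idem_iff.2 fun a b h => ?_⟩
  obtain ⟨δ, h1, h2⟩ := rel_tau_mul_sigma.1 h
  exact h1.functional h2

theorem rel_proj {α x : Mor C} : (proj α).Rel x x ↔ x ∈ ideal α := by
  rw [mem_ideal_iff]
  refine rel_tau_mul_sigma.trans ?_
  simp only [and_self]

theorem proj_ne_zero (α : Mor C) : proj α ≠ 0 :=
  (PBij.idem_ne_zero_iff (proj_mem_idem α).2).2 ⟨α, rel_proj.2 (mem_ideal_self α)⟩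

/-! ### Elements of the semigroup are finite joins of the `τ^α σ^β` -/

theorem isFiniteJoin_tau (α : Mor C) : IsFiniteJoin (tau α) := by
  refine ⟨{(path (𝟙 α.left), α)}, Set.finite_singleton _, ?_, fun x y => ?_⟩
  · rintro _ rfl
    rfl
  · rw [rel_tau]
    constructor
    · intro h
      exact ⟨_, rfl, x, tauRel_id_left_iff.2 ⟨rfl, h.middle_eq⟩, h⟩
    · rintro ⟨_, rfl, δ, h1, h2⟩
      obtain ⟨rfl, -⟩ := tauRel_id_left_iff.1 h1
      exact h2

/-- The only use of finite alignment itself. When a pair `q` of `t` is followed by a pair `p` of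
`s`, the intermediate point lies in the intersection of the ideals of `q.2` and `p.1`, a finite
union of ideals of elements `κ`. Writing `κ = q.2 a = p.1 b`, each `κ` contributes the pair `(q.1 a,
p.2 b)`, which is unique by left cancellation. -/
theorem IsFiniteJoin.mul (hfa : FinitelyAligned C) {s t : PBij (Mor C)} (hs : IsFiniteJoin s)
    (ht : IsFiniteJoin t) : IsFiniteJoin (s * t) := by
  obtain ⟨P, hP, hPl, hs⟩ := hs
  obtain ⟨Q, hQ, hQl, ht⟩ := ht
  choose G hG hGe using hfa
  refine ⟨⋃ q ∈ Q, ⋃ p ∈ P, ⋃ κ ∈ G q.2 p.1, {r | ∃ a b, TauRel q.2 a κ ∧ TauRel p.1 b κ ∧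
    TauRel q.1 a r.1 ∧ TauRel p.2 b r.2}, ?_, ?_, fun x z => ?_⟩
  · refine hQ.biUnion fun q _ => hP.biUnion fun p _ => (hG _ _).biUnion fun κ _ =>
      Set.Subsingleton.finite ?_
    rintro r ⟨a, b, h1, h2, h3, h4⟩ r' ⟨a', b', h1', h2', h3', h4'⟩
    obtain rfl := h1.cancel h1'
    obtain rfl := h2.cancel h2'
    exact Prod.ext (h3.functional h3') (h4.functional h4')
  · intro r hr
    simp only [Set.mem_iUnion] at hr
    obtain ⟨q, -, p, -, κ, -, a, b, h1, h2, h3, h4⟩ := hr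
    rw [h3.left_eq, h4.left_eq, ← h1.left_eq, ← h2.left_eq]
  · simp only [PBij.rel_mul, hs, ht, Set.mem_iUnion]
    constructor
    · rintro ⟨y, ⟨q, hq, ε, h1, h2⟩, p, hp, ζ, h3, h4⟩
      have hy : y ∈ ideal q.2 ∩ ideal p.1 := ⟨mem_ideal_iff.2 ⟨_, h2⟩, mem_ideal_iff.2 ⟨_, h3⟩⟩
      rw [hGe] at hy
      obtain ⟨κ, hκ, hy⟩ := Set.mem_iUnion₂.1 hy
      have hκ' : κ ∈ ideal q.2 ∩ ideal p.1 := by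
        rw [hGe]
        exact Set.mem_biUnion hκ (mem_ideal_self κ)
      -- With `y = κθ`, cancellation gives `ε = aθ` and `ζ = bθ`, hence `x = (q.1 a)θ` and `z = (p.2
      -- b)θ`.
      obtain ⟨θ, hθ⟩ := mem_ideal_iff.1 hy
      obtain ⟨a, ha⟩ := mem_ideal_iff.1 hκ'.1
      obtain ⟨b, hb⟩ := mem_ideal_iff.1 hκ'.2
      obtain ⟨ε', h5, h6⟩ := ha.assoc hθ
      obtain rfl := h6.cancel h2
      obtain ⟨ζ', h7, h8⟩ := hb.assoc hθ
      obtain rfl := h8.cancel h3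
      obtain ⟨r₁, h9, h10⟩ := h5.assoc' h1
      obtain ⟨r₂, h11, h12⟩ := h7.assoc' h4
      exact ⟨(r₁, r₂), ⟨q, hq, p, hp, κ, hκ, a, b, ha, hb, h9, h11⟩, θ, h10, h12⟩
    · rintro ⟨r, ⟨q, hq, p, hp, κ, hκ, a, b, ha, hb, h9, h11⟩, θ, h10, h12⟩
      obtain ⟨ε, h1, h2⟩ := h9.assoc h10
      obtain ⟨ζ, h3, h4⟩ := h11.assoc h12
      obtain ⟨y, hy⟩ := exists_tauRel (h1.middle_eq.trans ha.left_eq.symm)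
      obtain ⟨ε', h5, h6⟩ := ha.assoc hy
      obtain rfl := h1.functional h5
      obtain ⟨ζ', h7, h8⟩ := hb.assoc hy
      obtain rfl := h3.functional h7
      exact ⟨y, ⟨q, hq, ε, h2, h6⟩, p, hp, ζ, h8, h4⟩

theorem isFiniteJoin_of_mem (hfa : FinitelyAligned C) {s : PBij (Mor C)} (hs : s ∈ semigroup C) :
    IsFiniteJoin s := by
  change s ∈ Subsemigroup.closure _ at hs
  induction hs using Subsemigroup.closure_induction with
  | mem s hs =>
    obtain ⟨α, rfl | rfl⟩ := hs
    · exact (isFiniteJoin_tau α).inv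
    · exact isFiniteJoin_tau α
  | mul s t _ _ hs ht => exact hs.mul hfa ht

theorem left_eq_of_rel (hfa : FinitelyAligned C) {s : PBij (Mor C)} (hs : s ∈ semigroup C)
    {x y : Mor C} (h : s.Rel x y) : x.left = y.left := by
  obtain ⟨P, -, -, hP⟩ := isFiniteJoin_of_mem hfa hs
  obtain ⟨p, -, δ, h1, h2⟩ := (hP x y).1 h
  rw [h1.left_eq, h2.left_eq]

/-- The elements of the semigroup commute with right multiplication. -/
theorem rel_of_tauRel (hfa : FinitelyAligned C) {s : PBij (Mor C)} (hs : s ∈ semigroup C)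
    {x y ε x' y' : Mor C} (h : s.Rel x y) (hx : TauRel x ε x') (hy : TauRel y ε y') :
    s.Rel x' y' := by
  obtain ⟨P, -, -, hP⟩ := isFiniteJoin_of_mem hfa hs
  obtain ⟨p, hp, δ, h1, h2⟩ := (hP x y).1 h
  obtain ⟨ζ, h3, h4⟩ := h1.assoc hx
  obtain ⟨ζ', h5, h6⟩ := h2.assoc hy
  obtain rfl := h3.functional h5
  exact (hP x' y').2 ⟨p, hp, ζ, h4, h6⟩

theorem rel_of_mem_ideal (hfa : FinitelyAligned C) {f : PBij (Mor C)}
    (hf : f ∈ (semigroup C).idem) {x y : Mor C} (h : f.Rel x x) (hy : y ∈ ideal x) :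
    f.Rel y y := by
  obtain ⟨ε, hε⟩ := mem_ideal_iff.1 hy
  exact rel_of_tauRel hfa hf.1 h hε hε

/-- The domain of an idempotent is a finite union of sets `αΛ`. -/
theorem exists_finite_generators (hfa : FinitelyAligned C) {e : PBij (Mor C)}
    (he : e ∈ (semigroup C).idem) :
    ∃ A : Set (Mor C), A.Finite ∧ (∀ a ∈ A, e.Rel a a) ∧
      ∀ x, e.Rel x x → ∃ a ∈ A, x ∈ ideal a := by
  obtain ⟨P, hP, hl, h⟩ := isFiniteJoin_of_mem hfa he.1
  refine ⟨Prod.fst '' P, hP.image _, ?_, fun x hx => ?_⟩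
  · rintro _ ⟨p, hp, rfl⟩
    -- Taking `δ` to be the identity puts the pair itself on the graph of `e`, and that graph is
    -- diagonal.
    have h1 : e.Rel p.1 p.2 := by
      refine (h _ _).2 ⟨p, hp, _, tauRel_id p.1, ?_⟩
      rw [hl p hp]
      exact tauRel_id p.2
    have h2 := PBij.idem_iff.1 he.2 _ _ h1
    rwa [← h2] at h1
  · obtain ⟨p, hp, δ, h1, -⟩ := (h x x).1 hx
    exact ⟨_, ⟨p, hp, rfl⟩, mem_ideal_iff.2 ⟨δ, h1⟩⟩

/-! ### Weakly fixed idempotents in terms of the category -/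

/-- If `s` maps `a` to `b` and weakly fixes an idempotent with `a` in its domain, then `a δ` and
`b δ` have a common extension for all `δ`. -/
theorem meets_of_isWeaklyFixed (hfa : FinitelyAligned C) {s e : PBij (Mor C)}
    (hs : s ∈ semigroup C) (h : (semigroup C).IsWeaklyFixed s e) {a b δ x y : Mor C}
    (hab : s.Rel a b) (ha : e.Rel a a) (hx : TauRel a δ x) (hy : TauRel b δ y) : Meets y x := by
  have hxa : x ∈ ideal a := mem_ideal_iff.2 ⟨δ, hx⟩
  have hp := proj_mem_idem x
  -- Weak fixedness is tested on the idempotent with domain `xΛ`. It gives `d = xε` with `s d = c ∈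
  -- xΛ`, and `s d = yε` because `s x = y`.
  have h1 := h.2.2 _ hp (proj_ne_zero x) ((PBij.idemLE_iff hp.2 h.1.2).2 fun z hz =>
    rel_of_mem_ideal hfa h.1 ha (mem_ideal_trans hxa (rel_proj.1 hz)))
  rw [PBij.idem_mul_ne_zero_iff (PBij.idem_conj hp.2 s) hp.2] at h1
  obtain ⟨c, hc, hc'⟩ := h1
  obtain ⟨d, hdc, hd⟩ := (PBij.rel_conj hp.2).1 hc
  obtain ⟨ε, hε⟩ := mem_ideal_iff.1 (rel_proj.1 hd)
  have hxy : s.Rel x y := rel_of_tauRel hfa hs hab hx hy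
  obtain ⟨z, hz⟩ := exists_tauRel (hε.middle_eq.trans (left_eq_of_rel hfa hs hxy))
  obtain rfl := hdc.functional (rel_of_tauRel hfa hs hxy hε hz)
  exact ⟨c, mem_ideal_iff.2 ⟨ε, hz⟩, rel_proj.1 hc'⟩

/-- The left quotients by `a` of the elements of a finite set form a finite set. -/
theorem finite_setOf_tauRel' (a : Mor C) {F : Set (Mor C)} (hF : F.Finite) :
    {γ | ∃ κ ∈ F, TauRel a γ κ}.Finite := by
  have h : {γ | ∃ κ ∈ F, TauRel a γ κ} = ⋃ κ ∈ F, {γ | TauRel a γ κ} := by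
    ext κ
    simp
  rw [h]
  exact hF.biUnion fun γ _ => Set.Subsingleton.finite fun κ hκ κ' hκ' => hκ.cancel hκ'

/-! ### Covers by fixed idempotents versus exhaustive sets -/

theorem exists_cover_of_exists_exhaustive (hfa : FinitelyAligned C)
    (h : ∀ (x y : C) (α β : x ⟶ y),
      (∀ (w : C) (δ : w ⟶ x), Meets (path (δ ≫ α)) (path (δ ≫ β))) →
        ∃ F ∈ FE (path (𝟙 x)), ∀ (w : C) (γ : w ⟶ x), path γ ∈ F → γ ≫ α = γ ≫ β)
    {s e : PBij (Mor C)} (hs : s ∈ semigroup C) (hwf : (semigroup C).IsWeaklyFixed s e) :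
    ∃ Z : Set (PBij (Mor C)), Z.Finite ∧ (semigroup C).IsCover e Z ∧
      ∀ z ∈ Z, (semigroup C).IsFixed s z := by
  have hei := hwf.1
  have hdom := (PBij.idemLE_iff hei.2 (PBij.idem_inv_mul s)).1 hwf.2.1
  -- The cover is built separately over each generator `a` of the domain of `e`, as `K = aF` with
  -- `F` an exhaustive set for the pair `a`, `b = s a`.
  have hlocal : ∀ a, e.Rel a a → ∃ K : Set (Mor C), K.Finite ∧
      (∀ κ ∈ K, κ ∈ ideal a ∧ s.Rel κ κ) ∧ ∀ x ∈ ideal a, ∃ κ ∈ K, Meets κ x := by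
    intro a ha
    obtain ⟨b, hab⟩ := PBij.rel_inv_mul.1 (hdom a ha)
    have hl := left_eq_of_rel hfa hs hab
    have hr : b.right = a.right := by
      -- The identity in place of `δ` gives a common extension of `a` and `b`, so their ranges agree
      -- and they are parallel.
      have hid := tauRel_id b
      rw [← hl] at hid
      obtain ⟨c, hc, hc'⟩ := meets_of_isWeaklyFixed hfa hs hwf hab ha (tauRel_id a) hid
      rw [← right_eq_of_mem_ideal hc, right_eq_of_mem_ideal hc']
    obtain ⟨x, y, α⟩ := a
    obtain ⟨x', y', β⟩ := b
    obtain rfl : x = x' := hl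
    obtain rfl : y' = y := hr
    obtain ⟨F, ⟨hF, hFr, hFe⟩, hfix⟩ := h x y' β α fun w δ =>
      meets_of_isWeaklyFixed hfa hs hwf hab ha (tauRel_path α δ) (tauRel_path β δ)
    refine ⟨_, finite_setOf_tauRel (path α) hF, ?_, ?_⟩
    · rintro _ ⟨_, hγ, w, γ, rfl, rfl⟩
      refine ⟨⟨w, γ, rfl⟩, ?_⟩
      change w ⟶ x at γ
      have h1 : s.Rel (path (γ ≫ α)) (path (γ ≫ β)) :=
        rel_of_tauRel hfa hs hab (tauRel_path α γ) (tauRel_path β γ)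
      rw [hfix w γ hγ] at h1
      exact h1
    · rintro _ ⟨w, δ, rfl⟩
      obtain ⟨γ, hγ, c, hc, hc'⟩ := hFe (path δ) ⟨w, δ, (path_comp_id δ).symm⟩
      obtain ⟨κ, hκ⟩ := exists_tauRel (α := path α) (hFr γ hγ)
      refine ⟨κ, ⟨γ, hγ, hκ⟩, ?_⟩
      obtain ⟨ε, hε⟩ := mem_ideal_iff.1 hc
      obtain ⟨ε', hε'⟩ := mem_ideal_iff.1 hc'
      -- If `c` extends both `γ` and `δ`, then `d = αc` extends both `αγ` and `αδ`.
      obtain ⟨d, hd⟩ := exists_tauRel (α := path α) (hε.right_eq.trans (hFr γ hγ))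
      obtain ⟨κ', h1, h2⟩ := hε.assoc' hd
      obtain rfl := hκ.functional h1
      obtain ⟨κ'', h3, h4⟩ := hε'.assoc' hd
      obtain rfl := (tauRel_path α δ).functional h3
      exact ⟨d, mem_ideal_iff.2 ⟨_, h2⟩, mem_ideal_iff.2 ⟨_, h4⟩⟩
  obtain ⟨A, hA, hAe, hgen⟩ := exists_finite_generators hfa hei
  choose! K hK hKs hKe using hlocal
  refine ⟨⋃ a ∈ A, proj '' K a, hA.biUnion fun a ha => (hK a (hAe a ha)).image _,
    ⟨fun z hz => ?_, fun f hf h0 hfe => ?_⟩, fun z hz => ?_⟩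
  · simp only [Set.mem_iUnion] at hz
    obtain ⟨a, ha, κ, hκ, rfl⟩ := hz
    have hp := proj_mem_idem κ
    exact ⟨hp, (PBij.idemLE_iff hp.2 hei.2).2 fun c hc => rel_of_mem_ideal hfa hei (hAe a ha)
      (mem_ideal_trans (hKs a (hAe a ha) κ hκ).1 (rel_proj.1 hc))⟩
  · obtain ⟨x, hx⟩ := (PBij.idem_ne_zero_iff hf.2).1 h0
    obtain ⟨a, ha, hxa⟩ := hgen x ((PBij.idemLE_iff hf.2 hei.2).1 hfe x hx)
    obtain ⟨κ, hκ, c, hc, hc'⟩ := hKe a (hAe a ha) x hxa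
    refine ⟨proj κ, Set.mem_biUnion ha ⟨κ, hκ, rfl⟩, ?_⟩
    rw [PBij.idem_mul_ne_zero_iff (proj_mem_idem κ).2 hf.2]
    exact ⟨c, rel_proj.2 hc, rel_of_mem_ideal hfa hf hx hc'⟩
  · simp only [Set.mem_iUnion] at hz
    obtain ⟨a, ha, κ, hκ, rfl⟩ := hz
    have hp := proj_mem_idem κ
    have hfix : ∀ c, (proj κ).Rel c c → s.Rel c c := by
      intro c hc
      obtain ⟨ε, hε⟩ := mem_ideal_iff.1 (rel_proj.1 hc)
      exact rel_of_tauRel hfa hs (hKs a (hAe a ha) κ hκ).2 hε hε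
    exact ⟨hp, (PBij.idemLE_iff hp.2 (PBij.idem_inv_mul s)).2 fun c hc =>
      PBij.rel_inv_mul.2 ⟨c, hfix c hc⟩, (PBij.mul_idem_eq_iff hp.2).2 hfix⟩

/-- The map `τ^α σ^β` sends `βδ` to `αδ`. If a non-zero idempotent `f` has `βδ` in its domain, a
common extension `αδε` of `αδ` and `βδ` is again in that domain, and it is the image of `βδε`, which
is there as well. -/
theorem isWeaklyFixed_proj (hfa : FinitelyAligned C) {x y : C} {α β : x ⟶ y}
    (h : ∀ (w : C) (δ : w ⟶ x), Meets (path (δ ≫ α)) (path (δ ≫ β))) :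
    (semigroup C).IsWeaklyFixed (tau (path α) * sigma (path β)) (proj (path β)) := by
  have hp := proj_mem_idem (path β)
  have hrel : ∀ {w : C} (δ : w ⟶ x),
      (tau (path α) * sigma (path β)).Rel (path (δ ≫ β)) (path (δ ≫ α)) := fun δ =>
    rel_tau_mul_sigma.2 ⟨path δ, tauRel_path β δ, tauRel_path α δ⟩
  refine ⟨hp, (PBij.idemLE_iff hp.2 (PBij.idem_inv_mul _)).2 fun a ha => ?_, fun f hf h0 hfe => ?_⟩
  · obtain ⟨w, δ, rfl⟩ := rel_proj.1 ha
    exact PBij.rel_inv_mul.2 ⟨_, hrel δ⟩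
  · obtain ⟨a, ha⟩ := (PBij.idem_ne_zero_iff hf.2).1 h0
    obtain ⟨w, δ, rfl⟩ := rel_proj.1 ((PBij.idemLE_iff hf.2 hp.2).1 hfe a ha)
    change w ⟶ x at δ
    obtain ⟨c, ⟨v, ε, rfl⟩, hc'⟩ := h w δ
    change v ⟶ w at ε
    rw [PBij.idem_mul_ne_zero_iff (PBij.idem_conj hf.2 _) hf.2]
    refine ⟨_, (PBij.rel_conj hf.2).2 ⟨path (ε ≫ δ ≫ β), ?_, ?_⟩, rel_of_mem_ideal hfa hf ha hc'⟩
    · have h1 := hrel (ε ≫ δ)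
      rw [Category.assoc, Category.assoc] at h1
      exact h1
    · exact rel_of_mem_ideal hfa hf ha ⟨v, ε, rfl⟩

theorem exists_exhaustive_of_exists_cover (hfa : FinitelyAligned C)
    (h : ∀ s ∈ semigroup C, ∀ e : PBij (Mor C), (semigroup C).IsWeaklyFixed s e →
      ∃ Z : Set (PBij (Mor C)), Z.Finite ∧ (semigroup C).IsCover e Z ∧
        ∀ z ∈ Z, (semigroup C).IsFixed s z)
    {x y : C} {α β : x ⟶ y}
    (hm : ∀ (w : C) (δ : w ⟶ x), Meets (path (δ ≫ α)) (path (δ ≫ β))) :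
    ∃ F ∈ FE (path (𝟙 x)), ∀ (w : C) (γ : w ⟶ x), path γ ∈ F → γ ≫ α = γ ≫ β := by
  obtain ⟨Z, hZ, hZc, hZf⟩ := h _ ((semigroup C).mul_mem (tau_mem (path α)) (sigma_mem (path β)))
    _ (isWeaklyFixed_proj hfa hm)
  have hp := proj_mem_idem (path β)
  have hgen := fun z (hz : z ∈ Z) => exists_finite_generators hfa (hZc.1 z hz).1
  choose! A hA hAz hAgen using hgen
  -- The domains of the cover lie in `βΛ`, so their generators have the form `κ = βγ`; the
  -- exhaustive set consists of these `γ`.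
  refine ⟨⋃ z ∈ Z, {γ | ∃ κ ∈ A z, TauRel (path β) γ κ},
    ⟨hZ.biUnion fun z hz => finite_setOf_tauRel' _ (hA z hz), fun γ hγ => ?_, ?_⟩,
    fun w γ hγ => ?_⟩
  · simp only [Set.mem_iUnion] at hγ
    obtain ⟨z, hz, κ, hκ, h1⟩ := hγ
    exact h1.middle_eq
  · rintro _ ⟨w, δ, rfl⟩
    have hq := proj_mem_idem (path (δ ≫ β))
    -- The cover meets the idempotent with domain `βδΛ` in some `c`, which extends both `βγ` and
    -- `βδ`. Cancelling `β` gives a common extension of `γ` and `δ`.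
    obtain ⟨z, hz, h1⟩ := hZc.2 _ hq (proj_ne_zero _) ((PBij.idemLE_iff hq.2 hp.2).2 fun c hc =>
      rel_proj.2 (mem_ideal_trans ⟨w, δ, rfl⟩ (rel_proj.1 hc)))
    have hzi := (hZc.1 z hz).1
    rw [PBij.idem_mul_ne_zero_iff hzi.2 hq.2] at h1
    obtain ⟨c, hzc, hc⟩ := h1
    obtain ⟨κ, hκ, hcκ⟩ := hAgen z hz c hzc
    have hκβ := rel_proj.1 ((PBij.idemLE_iff hzi.2 hp.2).1 (hZc.1 z hz).2 κ (hAz z hz κ hκ))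
    obtain ⟨γ, hγ⟩ := mem_ideal_iff.1 hκβ
    refine ⟨γ, Set.mem_biUnion hz ⟨κ, hκ, hγ⟩, ?_⟩
    obtain ⟨ε, hε⟩ := mem_ideal_iff.1 hcκ
    obtain ⟨θ, hθ⟩ := mem_ideal_iff.1 (rel_proj.1 hc)
    obtain ⟨d, h1, h2⟩ := hγ.assoc hε
    obtain ⟨d', h3, h4⟩ := (tauRel_path β δ).assoc hθ
    obtain rfl := h2.cancel h4
    have h5 := path_comp_id δ
    exact ⟨d, mem_ideal_iff.2 ⟨ε, h1⟩, mem_ideal_iff.2 ⟨θ, h5 ▸ h3⟩⟩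
  · simp only [Set.mem_iUnion] at hγ
    obtain ⟨z, hz, κ, hκ, h1⟩ := hγ
    -- The map `τ^α σ^β` fixes `κ = βγ` but also sends it to `αγ`.
    have h2 := (PBij.mul_idem_eq_iff (hZc.1 z hz).1.2).1 (hZf z hz).2.2 κ (hAz z hz κ hκ)
    obtain ⟨δ, h3, h4⟩ := rel_tau_mul_sigma.1 h2
    obtain rfl := h3.cancel h1
    have h5 := (h4.functional (tauRel_path α γ)).symm.trans (h1.functional (tauRel_path β γ))
    simpa [path] using h5

end LCSC

theorem mainTheorem6 (C : Type u) [Category.{v} C] [LeftCancellative C]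
    (hcount : Countable (LCSC.Mor C)) (hfa : LCSC.FinitelyAligned C)
    (h : T2Space (LCSC.semigroup C).Germ ∨
      (LCSC.semigroup C).ultrafilters = (LCSC.semigroup C).tightFilters) :
    List.TFAE [
      (LCSC.semigroup C).TightGroupoidIsEffective,
      ∀ s ∈ LCSC.semigroup C, ∀ e : PBij (LCSC.Mor C), (LCSC.semigroup C).IsWeaklyFixed s e →
        ∃ Z : Set (PBij (LCSC.Mor C)), Z.Finite ∧ (LCSC.semigroup C).IsCover e Z ∧
          ∀ z ∈ Z, (LCSC.semigroup C).IsFixed s z,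
      ∀ (x y : C) (α β : x ⟶ y),
        (∀ (w : C) (δ : w ⟶ x), LCSC.Meets (LCSC.path (δ ≫ α)) (LCSC.path (δ ≫ β))) →
          ∃ F ∈ LCSC.FE (LCSC.path (𝟙 x)),
            ∀ (w : C) (γ : w ⟶ x), LCSC.path γ ∈ F → γ ≫ α = γ ≫ β] := by
  tfae_have 1 → 2 := fun heff _ hs _ hwf => heff.exists_cover hs hwf
  tfae_have 2 → 1 := InverseSubsemigroup.tightGroupoidIsEffective_of_exists_cover h
  tfae_have 2 → 3 := fun hcov _ _ _ _ hm => LCSC.exists_exhaustive_of_exists_cover hfa hcov hm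
  tfae_have 3 → 2 := fun hexh _ hs _ hwf =>
    LCSC.exists_cover_of_exists_exhaustive hfa hexh hs hwf
  tfae_finish
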